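/- Let $S=(a_k)_{k\ge 1}$ be a sequence of complex numbers with $0<|a_1|\le|a_2|\le\dots\to\infty$ whose exponent of convergence $\alpha=\limsup_{k\to\infty}\frac{\ln k}{\ln|a_k|}$ is finite, and let $\Psi\in[-\pi,\pi)$, $\varepsilon>0$ be such that no $a_k$ lies in the open sector $\Sigma=\{te^{i\theta}: t>0,\ |\theta-\Psi|<\varepsilon\}$. For $\operatorname{Re}s>\alpha$ put $\zeta_S(s)=\sum_{k\ge1}a_k^{-s}$, where $a^{-s}$ has its branch cut along the ray $\{te^{i\Psi}:t\ge0\}$ (arguments taken in $(\Psi-2\pi,\Psi)$). Let $F(z)=\sum_{j\ge0}c_jz^j$ be an entire function of growth order $\alpha$ whose zeros, counted with multiplicity, are the terms of $S$, and let $\ln F$ be a holomorphic branch of its logarithm on $\Sigma$. Define $$b_1=\frac{c_1}{c_0},\qquad b_j=\frac{c_j}{c_0}-\sum_{\ell=1}^{j-1}\frac{\ell}{j}\,\frac{c_{j-\ell}}{c_0}\,b_\ell\quad(j\ge2).$$ Let $m\ge1$ be an integer and $d_{j,k}$ $(j,k\ge0)$ complex numbers. For integers $N,M\ge0$ and $\delta>0$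 consider the expansion $$(E_{N,M,\delta})\qquad \ln F(z)=\sum_{j=0}^{N}\sum_{k=0}^{M}d_{j,k}\,z^{\alpha-j/m}\ln^kz+o\big(z^{\alpha-N/m-\delta}\big),\qquad z\to\infty,\ z\in\Sigma,$$ where $\ln(te^{i\theta})=\ln t+i\theta$ for $t>0$, $|\theta-\Psi|<\varepsilon$, and $z^\beta=e^{\beta\ln z}$. **(All orders.)** Suppose that for every $N$ there are $M$ and $\delta>0$ such that $(E_{N,M,\delta})$ holds. Then $\zeta_S$ has a meromorphic continuation to $\mathbb C$, and if $n\ne0$ is an integer with $n\le\alpha$ that is a regular point of (the continuation of) $\zeta_S$, then $$\zeta_S(n)=\begin{cases}-n\,b_n,& 1\le n\le\alpha \text{ and } \alpha-j/m\ne n\text{ for all } j,\\ n\,(d_{m(\alpha-n),0}-b_n),& 1\le n\le\alpha\text{ and } \alpha-j/m=n\text{ for some } j,\\ 0,& n<0\text{ and }\alpha-j/m\ne n\text{ for all } j,\\ n\,d_{m(\alpha-n),0},& n<0\text{ and }\alpha-j/m=n\text{ for some } j,\end{cases}$$ where $j$ ranges over the integers $j\ge0$. **(Finite order.)** Suppose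 only that $(E_{N,M,\delta})$ holds for some $N,M\ge0$ and some $\delta>0$. Then $\zeta_S$ has a meromorphic continuation to the half-plane $\operatorname{Re}s>\alpha-N/m-\delta$, and the same four formulas, with $j$ ranging over $\{0,\dots,N\}$, hold for every integer $n\ne0$ with $\alpha-N/m-\delta<n\le\alpha$ that is a regular point of $\zeta_S$. -/

import Mathlib

open Filter Topology Asymptotics Bornology

noncomputable section

/-- The open sector of all `z = t * exp (i θ)` with `t > 0` and `|θ - Ψ| < ε`. -/
def sector (Ψ ε : ℝ) : Set ℂ :=
  {z | z ≠ 0 ∧ |Complex.arg (z * Complex.exp (-(Ψ : ℂ) * Complex.I))| < ε}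

/-- The branch of the logarithm whose imaginary part lies in `(θ - π, θ + π]`. -/
def logAround (θ : ℝ) (z : ℂ) : ℂ :=
  Complex.log (z * Complex.exp (-(θ : ℂ) * Complex.I)) + (θ : ℂ) * Complex.I

/-- `z ^ s` with branch cut along the ray `{t * exp (i Ψ) : t ≥ 0}`, the argument of `z` being
taken in `(Ψ - 2π, Ψ]`. -/
def cutPow (Ψ : ℝ) (z s : ℂ) : ℂ :=
  Complex.exp (s * logAround (Ψ - Real.pi) z)

/-- The sequences to which a zeta function is attached. The sequence is indexed from `0`, so that
`a n` is the `(n + 1)`-st term; `α` is its exponent of convergence and the open sector of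
half-angle `ε` about the ray of argument `Ψ` contains none of its terms. -/
structure IsZetaSequence (a : ℕ → ℂ) (Ψ ε α : ℝ) : Prop where
  ne_zero : ∀ n, a n ≠ 0
  norm_mono : Monotone fun n => ‖a n‖
  norm_tendsto : Tendsto (fun n => ‖a n‖) atTop atTop
  exponent : limsup (fun n : ℕ =>
    ((Real.log ((n : ℝ) + 1) / Real.log ‖a n‖ : ℝ) : EReal)) atTop = (α : EReal)
  angle_mem : Ψ ∈ Set.Ico (-Real.pi) Real.pi
  eps_pos : 0 < ε
  avoids : ∀ n, a n ∉ sector Ψ ε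

/-- The growth order of an entire function: the infimum of all `ρ ≥ 0` with
`F z = O(exp (|z| ^ ρ))` as `z → ∞` (`⊤` if there is none). -/
def growthOrder (F : ℂ → ℂ) : ENNReal :=
  sInf {ρ | ∃ p : NNReal, ρ = (p : ENNReal) ∧
    F =O[cobounded ℂ] fun z => Real.exp (‖z‖ ^ (p : ℝ))}

/-- `F` is a characteristic function of minimal order of the sequence `a` with exponent of
convergence `α`: it is entire, its zeros are the terms of `a`, counted with multiplicity,
and its growth order is `α`. -/
structure IsCharacteristicFunction (a : ℕ → ℂ) (α : ℝ) (F : ℂ → ℂ) : Prop where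
  entire : Differentiable ℂ F
  zeros : ∀ z, analyticOrderAt F z = {n : ℕ | a n = z}.encard
  order : growthOrder F = ENNReal.ofReal α

/-- `L` is a holomorphic branch of `ln F` on `U`. -/
def IsLogBranchOn (F L : ℂ → ℂ) (U : Set ℂ) : Prop :=
  DifferentiableOn ℂ L U ∧ ∀ z ∈ U, Complex.exp (L z) = F z

/-- The expansion `L z = ∑_{j ≤ N} ∑_{k ≤ M} d j k * z ^ (α - j/m) * (ln z) ^ k
+ o(z ^ (α - N/m - δ))` as `z → ∞` in the sector about the ray of argument `Ψ`; powers and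
logarithms use the branch of `ln z` with `ln (t * exp (i Ψ)) = ln t + i Ψ`. -/
def HasLogExpansion (L : ℂ → ℂ) (Ψ ε α : ℝ) (m : ℕ) (d : ℕ → ℕ → ℂ)
    (N M : ℕ) (δ : ℝ) : Prop :=
  (fun z : ℂ => L z - ∑ j ∈ Finset.range (N + 1), ∑ k ∈ Finset.range (M + 1),
      d j k * Complex.exp (((α - (j : ℝ) / (m : ℝ) : ℝ) : ℂ) * logAround Ψ z)
        * logAround Ψ z ^ k)
    =o[cobounded ℂ ⊓ 𝓟 (sector Ψ ε)]
  fun z : ℂ => ‖z‖ ^ (α - (N : ℝ) / (m : ℝ) - δ)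

/-- `Z` is a meromorphic continuation to `U` of the zeta function `s ↦ ∑ (a n) ^ (-s)`,
which is given by the convergent series for `Re s > α`. -/
def IsZetaContinuation (a : ℕ → ℂ) (Ψ α : ℝ) (U : Set ℂ) (Z : ℂ → ℂ) : Prop :=
  MeromorphicOn Z U ∧ ∀ s : ℂ, α < s.re → HasSum (fun n => cutPow Ψ (a n) (-s)) (Z s)

/-- The Taylor coefficients of `F` at `0`. -/
def taylorCoeff (F : ℂ → ℂ) (j : ℕ) : ℂ := iteratedDeriv j F 0 / (Nat.factorial j : ℂ)

/-- The coefficients `b` with `b 1 = c 1 / c 0` and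
`b j = c j / c 0 - ∑_{1 ≤ ℓ < j} (ℓ / j) * (c (j - ℓ) / c 0) * b ℓ`
(see `logCoeff_rec`; the value at `0` is irrelevant). -/
def logCoeff (c : ℕ → ℂ) (j : ℕ) : ℂ :=
  if j = 0 then 0 else
    c j / c 0 - ∑ l : Fin j, ((l : ℕ) : ℂ) / (j : ℂ) * (c (j - l) / c 0) * logCoeff c l
termination_by j
decreasing_by exact l.2

theorem logCoeff_rec (c : ℕ → ℂ) {j : ℕ} (hj : 1 ≤ j) :
    logCoeff c j = c j / c 0 -
      ∑ l ∈ Finset.Ico 1 j, (l : ℂ) / (j : ℂ) * (c (j - l) / c 0) * logCoeff c l := by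
  rw [logCoeff, if_neg (by omega)]
  congr 1
  rw [Fin.sum_univ_eq_sum_range
    (fun l => (l : ℂ) / (j : ℂ) * (c (j - l) / c 0) * logCoeff c l) j,
    Finset.range_eq_Ico, Finset.sum_eq_sum_Ico_succ_bot (by omega)]
  simp

end

/-! Put `e = exp (iΨ)` and `p = ⌊α⌋`, so that `p ≤ α < p + 1`. Since `F` has order `α`, the function
`F'/F` minus its Taylor polynomial of degree `< p` equals `z^p ∑ a_k^{-p} / (z - a_k)`
(`tendsto_sum_taylorTail_logDeriv`). Let `f(t)` be `e` times this function at `z = t e` (`rayTail`).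
With `u_k = -e / a_k` it reads `∑ (-1)^p u_k^{p+1} t^p / (1 + u_k t)`, and the Mellin transform of
`1 / (1 + u t)` is `u^{-s} π / sin πs`. Integrating term by term for `α < Re s < p + 1` gives
(`mellin_rayTail`) `ζ(s) = e^{is(π-Ψ)} (sin πs / π) ∫_0^∞ t^{-s} f(t) dt`.

Here `f` is the derivative of `ln F(t e) - ∑_{i ≤ p} b_i (t e)^i` (`hasDerivAt_rayPrim`). The
integral over `(0, 1]` is holomorphic for `Re s < p + 1`. Over `(1, ∞)` one integrates by parts and
inserts the expansion of `ln F`: the remainder contributes a holomorphic function on `Re s > α - N/m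
- δ`, and a term `c z^β ln^k z` contributes `s c` times a function whose only singularity is the
principal part `k! / (s - β)^{k+1}` (`exists_logPole_eq`). The Taylor polynomial supplies further
terms with `c = -b_i`, `β = i`, `k = 0`. This is the continuation (`tsum_cutPow_eq_zetaCont`).

At an integer `n` the factor `e^{iπs} sin πs / π` vanishes like `s - n`. It kills everything
holomorphic there and leaves `n` times a polynomial in `1 / (s - n)`. If `n` is a regular point,
that polynomial is constant, equal to the sum of the coefficients with `β = n`, `k = 0`, namely
`d_{j,0}` if `α - j/m = n`, and `-b_n` if `n ≥ 1` (`apply_intCast_eq_of_eventuallyEq_zetaCont`). For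
an expansion to all orders the continuations to half-planes are glued. -/

/-! ### Taylor tails, and the Taylor coefficients of `F'/F`. -/

/-- The function `(f z - ∑_{i < n} f_i z ^ i) / z ^ n`, where the `f_i` are the Taylor
coefficients of `f` at `0`. -/
noncomputable def taylorTail (n : ℕ) (f : ℂ → ℂ) : ℂ → ℂ := (Function.swap dslope (0 : ℂ))^[n] f

theorem taylorTail_zero (f : ℂ → ℂ) : taylorTail 0 f = f := rfl

theorem taylorTail_succ (n : ℕ) (f : ℂ → ℂ) :
    taylorTail (n + 1) f = dslope (taylorTail n f) 0 := by
  simp [taylorTail, Function.iterate_succ_apply', Function.swap]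

theorem DifferentiableOn.taylorTail {f : ℂ → ℂ} {s : Set ℂ} (hs : s ∈ 𝓝 0)
    (hf : DifferentiableOn ℂ f s) (n : ℕ) : DifferentiableOn ℂ (taylorTail n f) s := by
  induction n with
  | zero => exact hf
  | succ n ih => rw [taylorTail_succ]; exact (Complex.differentiableOn_dslope hs).2 ih

/-- Each division by `z` costs a factor `2 / ρ` by the Schwarz lemma, the difference from the value
at `0` being at most twice the bound. -/
theorem norm_taylorTail_le {f : ℂ → ℂ} {ρ M : ℝ} (hρ : 0 < ρ)
    (hf : DifferentiableOn ℂ f (Metric.ball 0 ρ)) (hM : ∀ z ∈ Metric.ball (0 : ℂ) ρ, ‖f z‖ ≤ M)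
    (n : ℕ) : ∀ z ∈ Metric.ball (0 : ℂ) ρ, ‖taylorTail n f z‖ ≤ (2 / ρ) ^ n * M := by
  induction n with
  | zero => simpa [taylorTail_zero] using hM
  | succ n ih =>
    intro z hz
    rw [taylorTail_succ]
    have h := Complex.norm_dslope_le_div_of_mapsTo_ball (R₂ := 2 * ((2 / ρ) ^ n * M))
      (hf.taylorTail (Metric.ball_mem_nhds 0 hρ) n) (fun w hw => ?_) hz
    · refine h.trans (le_of_eq ?_)
      rw [pow_succ]; field_simp
    · rw [mem_closedBall_iff_norm]
      have := norm_sub_le (_root_.taylorTail n f w) (_root_.taylorTail n f 0)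
      linarith [ih w hw, ih 0 (Metric.mem_ball_self hρ)]

theorem dslope_congr_of_eqOn {f g : ℂ → ℂ} {s : Set ℂ} (hs : s ∈ 𝓝 0) (h : Set.EqOn f g s) :
    Set.EqOn (dslope f 0) (dslope g 0) s := by
  intro z hz
  rcases eq_or_ne z 0 with rfl | hne
  · rw [dslope_same, dslope_same]
    exact Filter.EventuallyEq.deriv_eq (Filter.eventuallyEq_of_mem hs h)
  · rw [dslope_of_ne _ hne, dslope_of_ne _ hne, slope_def_field, slope_def_field, h hz,
      h (mem_of_mem_nhds hs)]

/-- Partial fractions are eigenvectors of the tail operation: `((z - a)⁻¹ - (0 - a)⁻¹) / z = a⁻¹ (z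
- a)⁻¹`. -/
theorem dslope_sum_inv_add {ι : Type*} (S : Finset ι) (a c : ι → ℂ) (ha : ∀ k, a k ≠ 0)
    {h : ℂ → ℂ} (hh : DifferentiableAt ℂ h 0) {z : ℂ} (hz : ∀ k ∈ S, z ≠ a k) :
    dslope (fun z => ∑ k ∈ S, c k * (z - a k)⁻¹ + h z) 0 z =
      ∑ k ∈ S, c k * (a k)⁻¹ * (z - a k)⁻¹ + dslope h 0 z := by
  rcases eq_or_ne z 0 with rfl | hne
  · rw [dslope_same, dslope_same]
    have h1 : ∀ k ∈ S, HasDerivAt (fun z => c k * (z - a k)⁻¹) (c k * (a k)⁻¹ * (0 - a k)⁻¹) 0 := by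
      intro k _
      have := (((hasDerivAt_id (0 : ℂ)).sub_const (a k)).inv (by simpa using ha k)).const_mul (c k)
      refine this.congr_deriv ?_
      have := ha k
      simp only [id, zero_sub]
      field_simp
    exact ((HasDerivAt.fun_sum h1).add hh.hasDerivAt).deriv
  · rw [dslope_of_ne _ hne, dslope_of_ne _ hne, slope_def_field, slope_def_field]
    have : ∀ k ∈ S, c k * (a k)⁻¹ * (z - a k)⁻¹ =
        (c k * (z - a k)⁻¹ - c k * (0 - a k)⁻¹) / (z - 0) := by
      intro k hk
      have h1 := ha k
      have h2 : z - a k ≠ 0 := sub_ne_zero.2 (hz k hk)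
      simp only [sub_zero, zero_sub]
      field_simp
      ring
    rw [Finset.sum_congr rfl this, ← Finset.sum_div, Finset.sum_sub_distrib]
    ring

theorem taylorTail_sum_inv_add {ι : Type*} (S : Finset ι) (a : ι → ℂ) (ha : ∀ k, a k ≠ 0)
    {f g : ℂ → ℂ} {W : Set ℂ} (hW : W ∈ 𝓝 0) (hWa : ∀ z ∈ W, ∀ k ∈ S, z ≠ a k)
    (hg : DifferentiableOn ℂ g W) (hf : ∀ z ∈ W, f z = ∑ k ∈ S, (z - a k)⁻¹ + g z) (n : ℕ) :
    ∀ z ∈ W, taylorTail n f z = ∑ k ∈ S, ((a k)⁻¹) ^ n * (z - a k)⁻¹ + taylorTail n g z := by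
  induction n with
  | zero => simpa [taylorTail_zero] using hf
  | succ n ih =>
    intro z hz
    rw [taylorTail_succ, taylorTail_succ, dslope_congr_of_eqOn hW ih hz,
      dslope_sum_inv_add S a _ ha ((hg.taylorTail hW n).differentiableAt hW) (hWa z hz)]
    simp only [pow_succ]

theorem eq_sum_add_pow_mul_taylorTail (f : ℂ → ℂ) (n : ℕ) (z : ℂ) :
    f z = ∑ i ∈ Finset.range n, taylorTail i f 0 * z ^ i + z ^ n * taylorTail n f z := by
  induction n with
  | zero => simp [taylorTail_zero]
  | succ n ih =>
    have h := sub_smul_dslope (taylorTail n f) 0 z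
    rw [sub_zero, smul_eq_mul] at h
    rw [Finset.sum_range_succ, taylorTail_succ, pow_succ, mul_assoc, h]
    linear_combination ih

theorem taylorTail_apply_zero {f : ℂ → ℂ} (hf : AnalyticAt ℂ f 0) (n : ℕ) :
    taylorTail n f 0 = taylorCoeff f n := by
  have h := hf.hasFPowerSeriesAt.has_fpower_series_iterate_dslope_fslope n
  have h2 := h.coeff_zero 1
  rw [taylorTail, ← h2, taylorCoeff]
  have h3 := FormalMultilinearSeries.coeff_iterate_fslope (p := FormalMultilinearSeries.ofScalars ℂ
    (fun n ↦ iteratedDeriv n f 0 / (n.factorial : ℂ))) n 0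
  rw [FormalMultilinearSeries.coeff] at h3
  convert h3 using 1
  simp [FormalMultilinearSeries.coeff_ofScalars]

/-- The Taylor coefficients of a logarithmic derivative. -/
theorem taylorCoeff_logDeriv {F : ℂ → ℂ} (hF : Differentiable ℂ F) (h0 : F 0 ≠ 0) (n : ℕ) :
    taylorCoeff (logDeriv F) n = ((n : ℂ) + 1) * logCoeff (taylorCoeff F) (n + 1) := by
  have hFa : AnalyticAt ℂ F 0 := hF.analyticAt 0
  have hfa : AnalyticAt ℂ (logDeriv F) 0 := hFa.deriv.div hFa h0
  have hprod : deriv F =ᶠ[𝓝 0] logDeriv F * F := by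
    filter_upwards [hFa.continuousAt.eventually_ne h0] with z hz
    simp [logDeriv_apply, hz]
  -- Leibniz' rule for `F' = (F'/F) · F`; this is the recursion of `logCoeff` with `ℓ b_ℓ` in the
  -- role of the coefficient of index `ℓ - 1`.
  have hc : ∀ n : ℕ, ((n : ℂ) + 1) * taylorCoeff F (n + 1) =
      ∑ i ∈ Finset.range (n + 1), taylorCoeff (logDeriv F) i * taylorCoeff F (n - i) := by
    intro n
    have h1 : iteratedDeriv n (deriv F) 0 = _ := hprod.iteratedDeriv_eq n
    rw [iteratedDeriv_mul hfa.contDiffAt hFa.contDiffAt, ← iteratedDeriv_succ'] at h1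
    have hn : (n.factorial : ℂ) ≠ 0 := by exact_mod_cast n.factorial_ne_zero
    have h2 : ((n : ℂ) + 1) * taylorCoeff F (n + 1) = iteratedDeriv (n + 1) F 0 / n.factorial := by
      have : ((n : ℂ) + 1) ≠ 0 := by exact_mod_cast n.succ_ne_zero
      rw [taylorCoeff, Nat.factorial_succ]
      push_cast
      field_simp
    rw [h2, h1, Finset.sum_div]
    refine Finset.sum_congr rfl fun i hi => ?_
    have hi' : i ≤ n := Nat.lt_succ_iff.1 (Finset.mem_range.1 hi)
    have h4 : (i.factorial : ℂ) ≠ 0 := by exact_mod_cast i.factorial_ne_zero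
    have h5 : ((n - i).factorial : ℂ) ≠ 0 := by exact_mod_cast (n - i).factorial_ne_zero
    have h3 : (n.choose i : ℂ) * i.factorial * (n - i).factorial = n.factorial := by
      exact_mod_cast Nat.choose_mul_factorial_mul_factorial hi'
    rw [taylorCoeff, taylorCoeff]
    field_simp
    rw [← h3]
    ring
  have hc0 : taylorCoeff F 0 = F 0 := by simp [taylorCoeff]
  induction n using Nat.strong_induction_on with
  | _ n ih =>
    have h1 := hc n
    rw [Finset.sum_range_succ, Nat.sub_self] at h1
    rw [logCoeff_rec _ (by omega : 1 ≤ n + 1), Finset.sum_Ico_eq_sum_range]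
    have hne : ((n : ℂ) + 1) ≠ 0 := by exact_mod_cast n.succ_ne_zero
    have hc0' : taylorCoeff F 0 ≠ 0 := by rwa [hc0]
    rw [mul_sub, Finset.mul_sum]
    have h2 : ∀ i ∈ Finset.range (n + 1 - 1), ((n : ℂ) + 1) *
        (((1 + i : ℕ) : ℂ) / ((n + 1 : ℕ) : ℂ) *
          (taylorCoeff F (n + 1 - (1 + i)) / taylorCoeff F 0) *
          logCoeff (taylorCoeff F) (1 + i)) =
        taylorCoeff (logDeriv F) i * taylorCoeff F (n - i) / taylorCoeff F 0 := by
      intro i hi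
      have hi : i < n := by simpa using hi
      rw [ih i hi, show n + 1 - (1 + i) = n - i by omega, add_comm 1 i]
      push_cast
      field_simp
    rw [Finset.sum_congr rfl h2, ← Finset.sum_div, Nat.add_sub_cancel]
    field_simp
    linear_combination -h1

/-! ### The partial fraction expansion of `F'/F`. -/

/-- Zeros are divided out one at a time with `dslope`. Recording the orders of the cofactor as
counts of the remaining indices ensures that `a n` is still a zero when its turn comes, even if it
is repeated. -/
theorem exists_eq_prod_mul {a : ℕ → ℂ} (ha : ∀ n, a n ≠ 0) {F : ℂ → ℂ} (hF : Differentiable ℂ F)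
    (hz : ∀ z, analyticOrderAt F z = {n : ℕ | a n = z}.encard) (n : ℕ) :
    ∃ G : ℂ → ℂ, Differentiable ℂ G ∧
      (∀ z, F z = (∏ k ∈ Finset.range n, (1 - z / a k)) * G z) ∧
      ∀ z, analyticOrderAt G z = {k : ℕ | n ≤ k ∧ a k = z}.encard := by
  induction n with
  | zero => exact ⟨F, hF, by simp, by simpa using hz⟩
  | succ n ih =>
    obtain ⟨G, hG, hFG, hGo⟩ := ih
    have hGa : G (a n) = 0 := by
      apply apply_eq_zero_of_analyticOrderAt_ne_zero
      rw [hGo]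
      exact Set.encard_ne_zero.2 (show {k : ℕ | n ≤ k ∧ a k = a n}.Nonempty from ⟨n, le_rfl, rfl⟩)
    have hD : Differentiable ℂ (dslope G (a n)) := by
      rw [← differentiableOn_univ] at hG ⊢
      exact (Complex.differentiableOn_dslope univ_mem).2 hG
    have hGD : ∀ z, G z = (z - a n) * dslope G (a n) z := fun z => by
      have := sub_smul_dslope G (a n) z
      rw [hGa, sub_zero, smul_eq_mul] at this
      exact this.symm
    refine ⟨fun z => -a n * dslope G (a n) z, hD.const_mul _, fun z => ?_, fun z => ?_⟩
    · rw [hFG, Finset.prod_range_succ, hGD z]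
      have := ha n
      field_simp
      ring
    · have h1 : analyticOrderAt (fun z => -a n * dslope G (a n) z) z =
          analyticOrderAt (dslope G (a n)) z := by
        have : (fun z => -a n * dslope G (a n) z) = (fun _ => -a n) * dslope G (a n) := rfl
        rw [this, analyticOrderAt_mul analyticAt_const (hD.analyticAt z),
          analyticAt_const.analyticOrderAt_eq_zero.2 (neg_ne_zero.2 (ha n)), zero_add]
      have h2 : analyticOrderAt G z =
          analyticOrderAt (fun z => z - a n) z + analyticOrderAt (dslope G (a n)) z := by
        have : G = (fun z => z - a n) * dslope G (a n) := funext hGD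
        conv_lhs => rw [this]
        exact analyticOrderAt_mul (analyticAt_id.sub analyticAt_const) (hD.analyticAt z)
      rw [h1]
      rw [hGo] at h2
      rcases eq_or_ne z (a n) with rfl | hne
      · have h3 : {k : ℕ | n ≤ k ∧ a k = a n} = insert n {k : ℕ | n + 1 ≤ k ∧ a k = a n} := by
          ext k
          simp only [Set.mem_ofPred_eq, Set.mem_insert_iff]
          constructor
          · rintro ⟨h, h'⟩
            rcases h.eq_or_lt with rfl | h
            · exact Or.inl rfl
            · exact Or.inr ⟨h, h'⟩
          · rintro (rfl | ⟨h, h'⟩)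
            · exact ⟨le_rfl, rfl⟩
            · exact ⟨by omega, h'⟩
        have h4 : analyticOrderAt (fun z => z - a n) (a n) = 1 := analyticOrderAt_id_sub_const_self
        rw [h3, Set.encard_insert_of_notMem (by simp), h4, add_comm] at h2
        exact (WithTop.add_left_cancel ENat.one_ne_top h2).symm
      · have h4 : analyticOrderAt (fun z => z - a n) z = 0 := analyticOrderAt_id_sub_const_of_ne hne
        rw [h4, zero_add] at h2
        rw [← h2]
        congr 1
        ext k
        simp only [Set.mem_ofPred_eq]
        constructor
        · rintro ⟨h, h'⟩
          rcases h.eq_or_lt with rfl | h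
          · exact absurd h'.symm hne
          · exact ⟨h, h'⟩
        · rintro ⟨h, h'⟩
          exact ⟨by omega, h'⟩

/-- The logarithm `h` of `G / G 0` has real part at most `B`. Borel–Carathéodory gives `‖h‖ ≤ 2B` on
the ball of radius `R/2`, and Cauchy's estimate on circles of radius `R/4` bounds `h' = G'/G`. -/
theorem norm_logDeriv_le {G : ℂ → ℂ} {R B : ℝ} (hR : 0 < R) (hB : 0 < B)
    (hG : DifferentiableOn ℂ G (Metric.ball 0 R)) (hne : ∀ z ∈ Metric.ball (0 : ℂ) R, G z ≠ 0)
    (hGB : ∀ z ∈ Metric.ball (0 : ℂ) R, ‖G z‖ ≤ Real.exp B * ‖G 0‖) :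
    ∀ z ∈ Metric.ball (0 : ℂ) (R / 4), ‖logDeriv G z‖ ≤ 8 * B / R := by
  have h0 : (0 : ℂ) ∈ Metric.ball (0 : ℂ) R := Metric.mem_ball_self hR
  have hdiff : DifferentiableOn ℂ (logDeriv G) (Metric.ball 0 R) :=
    (hG.deriv Metric.isOpen_ball).div hG hne
  obtain ⟨h, hh0, hh⟩ := hdiff.isExactOn_ball.with_val_at 0 0
  have hconst : ∀ z ∈ Metric.ball (0 : ℂ) R, Complex.exp (-h z) * G z = G 0 := by
    intro z hz
    have h1 : ∀ w ∈ Metric.ball (0 : ℂ) R,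
        HasDerivAt (fun w => Complex.exp (-h w) * G w) 0 w := by
      intro w hw
      have h2 := (hh w hw).neg.cexp.mul
        (hG.differentiableAt (Metric.isOpen_ball.mem_nhds hw)).hasDerivAt
      refine h2.congr_deriv ?_
      rw [logDeriv_apply]
      have := hne w hw
      field_simp
      ring
    have := Metric.isOpen_ball.is_const_of_deriv_eq_zero
      (convex_ball (0 : ℂ) R).isPreconnected
      (fun w hw => (h1 w hw).differentiableAt.differentiableWithinAt)
      (fun w hw => (h1 w hw).deriv) hz h0
    simpa [hh0] using this
  have hre : Set.MapsTo h (Metric.ball 0 R) {z | z.re ≤ B} := by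
    intro z hz
    have h1 : ‖Complex.exp (-h z) * G z‖ = ‖G 0‖ := by rw [hconst z hz]
    rw [norm_mul, Complex.norm_exp, Complex.neg_re] at h1
    have h2 : 0 < ‖G 0‖ := norm_pos_iff.2 (hne 0 h0)
    have h3 := mul_le_mul_of_nonneg_left (hGB z hz) (Real.exp_pos (-(h z).re)).le
    rw [h1, ← mul_assoc, ← Real.exp_add] at h3
    have h4 : 1 ≤ Real.exp (-(h z).re + B) := by
      by_contra hlt
      push Not at hlt
      nlinarith
    have := Real.one_le_exp_iff.1 h4
    simp only [Set.mem_ofPred_eq]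
    linarith
  have hbd : ∀ z ∈ Metric.closedBall (0 : ℂ) (R / 2), ‖h z‖ ≤ 2 * B := by
    intro z hz
    have hz' : ‖z‖ ≤ R / 2 := by simpa using hz
    refine (Complex.borelCaratheodory_zero hB
      (fun w hw => (hh w hw).differentiableAt.differentiableWithinAt) hre hR
      (by simp; linarith) hh0).trans ?_
    rw [div_le_iff₀ (by linarith)]
    nlinarith
  intro z hz
  have hz' : ‖z‖ < R / 4 := by simpa using hz
  have hzR : z ∈ Metric.ball (0 : ℂ) R := by simp; linarith
  rw [← (hh z hzR).deriv]
  have hsub : Metric.closedBall z (R / 4) ⊆ Metric.closedBall 0 (R / 2) := by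
    apply Metric.closedBall_subset_closedBall'
    simp; linarith
  have := Complex.norm_deriv_le_of_forall_mem_sphere_norm_le (f := h) (c := z) (R := R / 4)
    (C := 2 * B) (by linarith) ?_ (fun w hw => hbd w (hsub (Metric.sphere_subset_closedBall hw)))
  · refine this.trans (le_of_eq ?_)
    field_simp
    norm_num
  · have : DifferentiableOn ℂ h (Metric.closedBall z (R / 4)) := fun w hw =>
      (hh w (by have := hsub hw; simp at this ⊢; linarith)).differentiableAt.differentiableWithinAt
    exact this.diffContOnCl_ball subset_rfl

theorem isBigO_exp_rpow_of_growthOrder_lt {F : ℂ → ℂ} {α β : ℝ}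
    (h : growthOrder F = ENNReal.ofReal α) (hβ : 0 < β) (hαβ : α < β) :
    F =O[cobounded ℂ] fun z => Real.exp (‖z‖ ^ β) := by
  have h1 : growthOrder F < ENNReal.ofReal β := by
    rw [h]; exact (ENNReal.ofReal_lt_ofReal_iff hβ).2 hαβ
  obtain ⟨ρ, ⟨p, rfl, hp⟩, hρ⟩ := sInf_lt_iff.1 h1
  have hp' : (p : ℝ) < β := by
    rw [ENNReal.ofReal, ENNReal.coe_lt_coe] at hρ
    simpa [hβ.le] using (NNReal.coe_lt_coe.2 hρ)
  refine hp.trans (IsBigO.of_bound 1 ?_)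
  filter_upwards [(tendsto_norm_cobounded_atTop (E := ℂ)).eventually_ge_atTop 1] with z hz
  rw [one_mul, Real.norm_of_nonneg (Real.exp_pos _).le, Real.norm_of_nonneg (Real.exp_pos _).le]
  exact Real.exp_le_exp.2 (Real.rpow_le_rpow_of_exponent_le hz hp'.le)

/-- Quantitative form of the partial fraction expansion of `F' / F`. -/
theorem norm_taylorTail_logDeriv_sub_le {a : ℕ → ℂ} (ha : ∀ n, a n ≠ 0)
    (hmono : Monotone fun n => ‖a n‖) {F : ℂ → ℂ} (hF : Differentiable ℂ F)
    (hz : ∀ z, analyticOrderAt F z = {n : ℕ | a n = z}.encard) (p n : ℕ) {B : ℝ} (hB : 0 < B)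
    (hFB : ∀ z, ‖z‖ = 2 * ‖a n‖ → ‖F z‖ ≤ Real.exp B * ‖F 0‖)
    {z : ℂ} (hFz : F z ≠ 0) (hzn : ‖z‖ < ‖a n‖ / 4) :
    ‖taylorTail p (logDeriv F) z - ∑ k ∈ Finset.range n, ((a k)⁻¹) ^ p * (z - a k)⁻¹‖ ≤
      (2 / (‖a n‖ / 4)) ^ p * (8 * B / ‖a n‖) := by
  obtain ⟨G, hG, hFG, hGo⟩ := exists_eq_prod_mul ha hF hz n
  set R := ‖a n‖ with hRdef
  have hR : 0 < R := norm_pos_iff.2 (ha n)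
  have hG0 : G 0 = F 0 := by rw [hFG 0]; simp
  have hGne : ∀ z ∈ Metric.ball (0 : ℂ) R, G z ≠ 0 := by
    intro z hz
    rw [← (hG.analyticAt z).analyticOrderAt_eq_zero, hGo, Set.encard_eq_zero,
      Set.eq_empty_iff_forall_notMem]
    rintro k ⟨hk, rfl⟩
    have := hmono hk
    simp only [mem_ball_zero_iff] at hz
    simp only at this
    linarith
  have hGB : ∀ z ∈ Metric.ball (0 : ℂ) R, ‖G z‖ ≤ Real.exp B * ‖G 0‖ := by
    intro z hz
    -- Maximum principle: on the circle of radius `2 ‖a n‖` each factor satisfies `|1 - w / a k| ≥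
    -- 1`, because `‖a k‖ ≤ ‖a n‖`, so `G` is bounded by `F` there.
    refine Complex.norm_le_of_forall_mem_frontier_norm_le (U := Metric.ball 0 (2 * R))
      Metric.isBounded_ball hG.diffContOnCl ?_
      (subset_closure (Metric.ball_subset_ball (by linarith) hz))
    intro w hw
    rw [frontier_ball _ (by positivity), mem_sphere_zero_iff_norm] at hw
    have h1 := hFB w hw
    rw [hFG w, norm_mul] at h1
    have h2 : 1 ≤ ‖∏ k ∈ Finset.range n, (1 - w / a k)‖ := by
      rw [norm_prod]
      refine Finset.one_le_prod fun k hk => ?_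
      have h3 : ‖a k‖ ≤ R := hmono (Finset.mem_range.1 hk).le
      have h4 : 2 ≤ ‖w / a k‖ := by
        rw [norm_div, hw, le_div_iff₀ (norm_pos_iff.2 (ha k))]
        linarith
      have h5 := norm_sub_norm_le (w / a k) 1
      rw [norm_one, norm_sub_rev] at h5
      linarith
    rw [hG0]
    nlinarith [norm_nonneg (G w)]
  have hlog := norm_logDeriv_le hR hB hG.differentiableOn hGne hGB
  have hball : Metric.ball (0 : ℂ) (R / 4) ⊆ Metric.ball 0 R :=
    Metric.ball_subset_ball (by linarith)
  have hfdiff : DifferentiableOn ℂ (logDeriv G) (Metric.ball 0 (R / 4)) :=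
    (hG.differentiableOn.deriv Metric.isOpen_ball).div hG.differentiableOn
      fun z hz => hGne z (hball hz)
  have hF0 : F 0 ≠ 0 := hG0 ▸ hGne 0 (Metric.mem_ball_self hR)
  set W : Set ℂ := Metric.ball 0 (R / 4) ∩ {z | F z ≠ 0}
  have hW : W ∈ 𝓝 0 := Filter.inter_mem (Metric.ball_mem_nhds _ (by positivity))
    (hF.continuous.continuousAt.eventually_ne hF0)
  have hzW : z ∈ W := ⟨by simpa using hzn, hFz⟩
  have hfac : ∀ w ∈ W, ∀ k ∈ Finset.range n, 1 - w / a k ≠ 0 := by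
    intro w hw k hk h0
    apply hw.2
    rw [hFG w, Finset.prod_eq_zero hk h0, zero_mul]
  have hWa : ∀ w ∈ W, ∀ k ∈ Finset.range n, w ≠ a k := by
    rintro w hw k hk rfl
    exact hfac _ hw k hk (by rw [div_self (ha k), sub_self])
  -- Removing the first `n` partial fractions turns the tail of `F'/F` into that of `G'/G`. The
  -- identity is only available off the zeros of `F`, hence `W`.
  have key := taylorTail_sum_inv_add (f := logDeriv F) (g := logDeriv G) (Finset.range n) a ha hW
    hWa (hfdiff.mono Set.inter_subset_left) (fun w hw => ?_) p z hzW
  · rw [key, add_sub_cancel_left]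
    exact norm_taylorTail_le (by positivity) hfdiff hlog p z (by simpa using hzn)
  · have hFeq : F = fun w => (∏ k ∈ Finset.range n, (1 - w / a k)) * G w := funext hFG
    have hd : ∀ k ∈ Finset.range n, DifferentiableAt ℂ (fun w => 1 - w / a k) w := by
      intro k _
      fun_prop
    rw [hFeq, logDeriv_mul w (Finset.prod_ne_zero_iff.2 (hfac w hw)) (hGne w (hball hw.1))
      (DifferentiableAt.fun_finsetProd hd) (hG w),
      logDeriv_prod (f := fun k w => 1 - w / a k) (hfac w hw) hd]
    congr 1
    refine Finset.sum_congr rfl fun k hk => ?_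
    have h1 : HasDerivAt (fun w => 1 - w / a k) (-(1 / a k)) w :=
      ((hasDerivAt_id w).div_const (a k)).const_sub 1
    rw [logDeriv_apply, h1.deriv]
    have h2 := ha k
    have h3 := hfac w hw k hk
    have h4 : w - a k ≠ 0 := sub_ne_zero.2 (hWa w hw k hk)
    field_simp
    rw [eq_comm, ← neg_sub, neg_div, ← neg_div_neg_eq, neg_neg, ← neg_sub w, neg_neg, div_self h4]

/-- The partial fraction expansion of `F' / F` for an entire function `F` of finite order. -/
theorem tendsto_sum_taylorTail_logDeriv {a : ℕ → ℂ} (ha : ∀ n, a n ≠ 0)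
    (hmono : Monotone fun n => ‖a n‖) (hlim : Tendsto (fun n => ‖a n‖) atTop atTop)
    {F : ℂ → ℂ} (hF : Differentiable ℂ F)
    (hz : ∀ z, analyticOrderAt F z = {n : ℕ | a n = z}.encard) {β : ℝ}
    (hFO : F =O[cobounded ℂ] fun z => Real.exp (‖z‖ ^ β)) {p : ℕ} (hp : β < p + 1)
    {z : ℂ} (hFz : F z ≠ 0) :
    Tendsto (fun n => ∑ k ∈ Finset.range n, ((a k)⁻¹) ^ p * (z - a k)⁻¹) atTop
      (𝓝 (taylorTail p (logDeriv F) z)) := by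
  have hF0 : F 0 ≠ 0 := by
    rw [← (hF.analyticAt 0).analyticOrderAt_eq_zero, hz, Set.encard_eq_zero,
      Set.eq_empty_iff_forall_notMem]
    exact fun k hk => ha k hk
  obtain ⟨C, hC⟩ := hFO.bound
  -- The maximum with `1` makes `log C'` nonnegative, so that the exponent `B` below is positive.
  set C' := max 1 (C / ‖F 0‖)
  have hF0' : 0 < ‖F 0‖ := norm_pos_iff.2 hF0
  rw [← tendsto_sub_nhds_zero_iff]
  have hcob : ∀ᶠ r in atTop, ∀ z : ℂ, ‖z‖ = r → ‖F z‖ ≤ C * ‖Real.exp (‖z‖ ^ β)‖ := by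
    rw [← comap_norm_atTop, eventually_comap] at hC
    exact hC
  have hbd : ∀ᶠ n in atTop, ‖(∑ k ∈ Finset.range n, ((a k)⁻¹) ^ p * (z - a k)⁻¹) -
      taylorTail p (logDeriv F) z‖ ≤
      (2 / (‖a n‖ / 4)) ^ p * (8 * ((2 * ‖a n‖) ^ β + Real.log C') / ‖a n‖) := by
    have h2 : Tendsto (fun n => 2 * ‖a n‖) atTop atTop := hlim.const_mul_atTop (by norm_num)
    filter_upwards [h2.eventually hcob, hlim.eventually_gt_atTop (4 * ‖z‖)] with n hn hn2
    rw [norm_sub_rev]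
    have hlog : 0 ≤ Real.log C' := Real.log_nonneg (le_max_left _ _)
    have hpos : 0 < ‖a n‖ := norm_pos_iff.2 (ha n)
    refine norm_taylorTail_logDeriv_sub_le ha hmono hF hz p n (by positivity) (fun w hw => ?_) hFz
      (by linarith)
    refine (hn w hw).trans ?_
    rw [Real.norm_of_nonneg (Real.exp_pos _).le, hw, Real.exp_add,
      Real.exp_log (lt_of_lt_of_le one_pos (le_max_left _ _))]
    have h3 : C ≤ C' * ‖F 0‖ := by
      rw [← div_le_iff₀ hF0']; exact le_max_right _ _
    have h4 := Real.exp_pos ((2 * ‖a n‖) ^ β)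
    nlinarith
  refine squeeze_zero_norm' hbd ?_
  -- The error is a combination of `x^(β - p - 1)` and `x^(-p - 1)`; this is where `β < p + 1`
  -- enters.
  have hlim0 : Tendsto (fun x : ℝ => (2 / (x / 4)) ^ p * (8 * ((2 * x) ^ β + Real.log C') / x))
      atTop (𝓝 0) := by
    have h1 : Tendsto (fun x : ℝ => (8 ^ p * 8 * 2 ^ β) * x ^ (-((p + 1 : ℝ) - β)) +
        (8 ^ p * 8 * Real.log C') * x ^ (-(p + 1 : ℝ))) atTop (𝓝 0) := by
      have e1 := (tendsto_rpow_neg_atTop (y := (p + 1 : ℝ) - β) (by linarith)).const_mul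
        (8 ^ p * 8 * (2 : ℝ) ^ β)
      have e2 := (tendsto_rpow_neg_atTop (y := (p + 1 : ℝ)) (by positivity)).const_mul
        (8 ^ p * 8 * Real.log C')
      simpa using e1.add e2
    refine h1.congr' ?_
    filter_upwards [eventually_gt_atTop 0] with x hx
    have e1 : x ^ (-((p + 1 : ℝ) - β)) = x ^ β / x ^ (p + 1) := by
      rw [neg_sub, Real.rpow_sub hx]
      norm_cast
    have e2 : x ^ (-(p + 1 : ℝ)) = 1 / x ^ (p + 1) := by
      rw [Real.rpow_neg hx.le, one_div]
      norm_cast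
    rw [e1, e2, Real.mul_rpow (by norm_num) hx.le]
    have e3 : (2 / (x / 4)) ^ p = 8 ^ p / x ^ p := by
      rw [← div_pow]; congr 1; field_simp; norm_num
    rw [e3, pow_succ]
    field_simp
  exact hlim0.comp hlim

/-! ### The Mellin transform of `1 / (1 + u t)`. -/

/-- With `τ = t / (1 + t)`, the quotient `(1 + u t) / (1 + t) = (1 - τ) + τ u` runs over the segment
from `1` to `u`. The slit plane is star-shaped about `1`, so the segment avoids `0`, and compactness
of `[0, 1] × K` makes this uniform. -/
theorem exists_mul_one_add_le_norm_one_add_mul {K : Set ℂ} (hK : IsCompact K)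
    (hKs : K ⊆ Complex.slitPlane) :
    ∃ c : ℝ, 0 < c ∧ ∀ u ∈ K, ∀ t : ℝ, 0 ≤ t → c * (1 + t) ≤ ‖1 + u * t‖ := by
  have hcomp : IsCompact (Set.Icc (0 : ℝ) 1 ×ˢ K) := isCompact_Icc.prod hK
  have hcont : ContinuousOn (fun x : ℝ × ℂ => ‖(1 - (x.1 : ℂ)) + x.1 * x.2‖)
      (Set.Icc (0 : ℝ) 1 ×ˢ K) := by fun_prop
  have hpos : ∀ x ∈ Set.Icc (0 : ℝ) 1 ×ˢ K, 0 < ‖(1 - (x.1 : ℂ)) + x.1 * x.2‖ := by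
    rintro ⟨τ, u⟩ ⟨hτ, hu⟩
    rw [norm_pos_iff]
    have h := Complex.starConvex_one_slitPlane (hKs hu) (sub_nonneg.2 hτ.2) hτ.1 (by ring)
    have h2 := Complex.slitPlane_ne_zero h
    simpa using h2
  obtain ⟨c, hc, hcb⟩ := hcomp.exists_forall_le' hcont hpos
  refine ⟨c, hc, fun u hu t ht => ?_⟩
  have h1 : (0 : ℝ) < 1 + t := by linarith
  have h1' : (1 + (t : ℂ)) ≠ 0 := by exact_mod_cast h1.ne'
  have h2 := hcb (t / (1 + t), u) ⟨⟨by positivity, (div_le_one h1).2 (by linarith)⟩, hu⟩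
  have h3 : 1 + u * t = ((1 + t : ℝ) : ℂ) * ((1 - ((t / (1 + t) : ℝ) : ℂ)) +
      ((t / (1 + t) : ℝ) : ℂ) * u) := by
    push_cast
    field_simp
    ring
  rw [h3, norm_mul, Complex.norm_real, Real.norm_of_nonneg h1.le, mul_comm]
  exact mul_le_mul_of_nonneg_left h2 h1.le

theorem one_add_mul_ne_zero_of_mem_slitPlane {u : ℂ} (hu : u ∈ Complex.slitPlane) {t : ℝ}
    (ht : 0 ≤ t) : 1 + u * t ≠ 0 := by
  obtain ⟨c, hc, h⟩ := exists_mul_one_add_le_norm_one_add_mul (isCompact_singleton (x := u))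
    (by simpa using hu)
  exact norm_pos_iff.1 (lt_of_lt_of_le (by positivity) (h u rfl t ht))

theorem continuousOn_one_add_mul_inv_Ioi {u : ℂ} (hu : u ∈ Complex.slitPlane) :
    ContinuousOn (fun t : ℝ => (1 + u * (t : ℂ))⁻¹) (Set.Ioi 0) :=
  ContinuousOn.inv₀ (by fun_prop) fun _ ht =>
    one_add_mul_ne_zero_of_mem_slitPlane hu (Set.mem_Ioi.1 ht).le

theorem integrableOn_rpow_mul_one_add_inv {σ : ℝ} (h0 : 0 < σ) (h1 : σ < 1) :
    MeasureTheory.IntegrableOn (fun t : ℝ => t ^ (σ - 1) * (1 + t)⁻¹) (Set.Ioi 0) := by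
  refine mellin_convergent_of_isBigO_scalar (a := 1) (b := 0) (f := fun t : ℝ => (1 + t)⁻¹)
    ?_ ?_ h1 ?_ h0
  · refine ContinuousOn.locallyIntegrableOn (ContinuousOn.inv₀ (by fun_prop) fun t ht => ?_)
      measurableSet_Ioi
    have := Set.mem_Ioi.1 ht
    positivity
  · refine IsBigO.of_bound 1 ?_
    filter_upwards [eventually_gt_atTop 0] with t ht
    rw [Real.rpow_neg_one, norm_inv, norm_inv, one_mul, Real.norm_of_nonneg ht.le,
      Real.norm_of_nonneg (by linarith)]
    exact inv_anti₀ ht (by linarith)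
  · refine IsBigO.of_bound 1 ?_
    filter_upwards [self_mem_nhdsWithin] with t ht
    have ht : 0 < t := ht
    rw [neg_zero, Real.rpow_zero, norm_inv, norm_one, one_mul,
      Real.norm_of_nonneg (by linarith)]
    exact inv_le_one_of_one_le₀ (by linarith)

theorem aestronglyMeasurable_cpow_mul_one_add_mul_inv {u : ℂ} (hu : u ∈ Complex.slitPlane)
    (s : ℂ) (n : ℕ) : MeasureTheory.AEStronglyMeasurable
      (fun t : ℝ => (t : ℂ) ^ s * (1 + u * (t : ℂ))⁻¹ ^ n)
      (MeasureTheory.volume.restrict (Set.Ioi 0)) := by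
  refine ContinuousOn.aestronglyMeasurable ?_ measurableSet_Ioi
  refine ContinuousOn.mul (fun t ht => ?_) ((continuousOn_one_add_mul_inv_Ioi hu).pow n)
  exact (Complex.continuousAt_ofReal_cpow_const _ _
    (Or.inr (Set.mem_Ioi.1 ht).ne')).continuousWithinAt

theorem mellinConvergent_one_add_mul_inv {s : ℂ} (h0 : 0 < s.re) (h1 : s.re < 1) {u : ℂ}
    (hu : u ∈ Complex.slitPlane) : MellinConvergent (fun t : ℝ => (1 + u * (t : ℂ))⁻¹) s := by
  obtain ⟨c, hc, h⟩ := exists_mul_one_add_le_norm_one_add_mul (isCompact_singleton (x := u))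
    (by simpa using hu)
  refine MeasureTheory.Integrable.mono'
    ((integrableOn_rpow_mul_one_add_inv h0 h1).const_mul c⁻¹) ?_ ?_
  · simpa using aestronglyMeasurable_cpow_mul_one_add_mul_inv hu (s - 1) 1
  · refine (MeasureTheory.ae_restrict_iff' measurableSet_Ioi).2 (Eventually.of_forall fun t ht => ?_)
    have ht : 0 < t := ht
    have := h u rfl t ht.le
    rw [norm_smul, Complex.norm_cpow_eq_rpow_re_of_pos ht, norm_inv, Complex.sub_re,
      Complex.one_re, ← mul_assoc, mul_comm c⁻¹, mul_assoc, ← mul_inv]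
    gcongr

/-- Differentiation under the integral sign; holomorphy in `u` lets the identity theorem carry the
formula from `u > 0` to the slit plane. -/
theorem differentiableAt_mellin_one_add_mul_inv {s : ℂ} (h0 : 0 < s.re) (h1 : s.re < 1) {u : ℂ}
    (hu : u ∈ Complex.slitPlane) :
    DifferentiableAt ℂ (fun u => mellin (fun t : ℝ => (1 + u * (t : ℂ))⁻¹) s) u := by
  obtain ⟨ρ, hρ, hsub⟩ := Metric.nhds_basis_closedBall.mem_iff.1
    (Complex.isOpen_slitPlane.mem_nhds hu)
  obtain ⟨c, hc, h⟩ := exists_mul_one_add_le_norm_one_add_mul (isCompact_closedBall u ρ) hsub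
  refine (hasDerivAt_integral_of_dominated_loc_of_deriv_le
    (μ := MeasureTheory.volume.restrict (Set.Ioi 0))
    (F := fun u (t : ℝ) => (t : ℂ) ^ (s - 1) • (1 + u * (t : ℂ))⁻¹)
    (F' := fun u (t : ℝ) => -((t : ℂ) ^ s * (1 + u * (t : ℂ))⁻¹ ^ 2))
    (bound := fun t => c⁻¹ ^ 2 * (t ^ (s.re - 1) * (1 + t)⁻¹))
    (Metric.closedBall_mem_nhds u hρ) ?_ (mellinConvergent_one_add_mul_inv h0 h1 hu)
    (aestronglyMeasurable_cpow_mul_one_add_mul_inv hu s 2).neg ?_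
    ((integrableOn_rpow_mul_one_add_inv h0 h1).const_mul _) ?_).2.differentiableAt
  · filter_upwards [Complex.isOpen_slitPlane.mem_nhds hu] with v hv
    simpa using aestronglyMeasurable_cpow_mul_one_add_mul_inv hv (s - 1) 1
  · refine (MeasureTheory.ae_restrict_iff' measurableSet_Ioi).2
      (Eventually.of_forall fun t ht v hv => ?_)
    have ht : 0 < t := ht
    have := h v hv t ht.le
    rw [norm_neg, norm_mul, Complex.norm_cpow_eq_rpow_re_of_pos ht, norm_pow, norm_inv]
    calc t ^ s.re * ‖1 + v * t‖⁻¹ ^ 2 ≤ t ^ s.re * (c * (1 + t))⁻¹ ^ 2 := by gcongr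
      _ = c⁻¹ ^ 2 * (t ^ (s.re - 1) * (1 + t)⁻¹) * (t * (1 + t)⁻¹) := by
        rw [Real.rpow_sub_one ht.ne']
        field_simp
      _ ≤ c⁻¹ ^ 2 * (t ^ (s.re - 1) * (1 + t)⁻¹) * 1 := by
        gcongr
        rw [← div_eq_mul_inv, div_le_one (by linarith)]
        linarith
      _ = _ := mul_one _
  · refine (MeasureTheory.ae_restrict_iff' measurableSet_Ioi).2
      (Eventually.of_forall fun t ht v hv => ?_)
    have ht : 0 < t := ht
    have hne := one_add_mul_ne_zero_of_mem_slitPlane (hsub hv) ht.le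
    have h2 : HasDerivAt (fun v : ℂ => 1 + v * (t : ℂ)) t v := by
      simpa using ((hasDerivAt_id v).mul_const (t : ℂ)).const_add 1
    refine ((h2.inv hne).const_smul ((t : ℂ) ^ (s - 1))).congr_deriv ?_
    rw [smul_eq_mul, Complex.cpow_sub _ _ (by exact_mod_cast ht.ne'), Complex.cpow_one]
    have : (t : ℂ) ≠ 0 := by exact_mod_cast ht.ne'
    field_simp

/-- The substitution `t = x / (1 - x)` gives the Beta integral `B(s, 1 - s) = Γ(s) Γ(1 - s)`, and
the reflection formula evaluates it. -/
theorem mellin_one_add_inv {s : ℂ} (h0 : 0 < s.re) (h1 : s.re < 1) :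
    mellin (fun t : ℝ => (1 + (t : ℂ))⁻¹) s = Real.pi / Complex.sin (Real.pi * s) := by
  rw [← Complex.Gamma_mul_Gamma_one_sub, Complex.Gamma_mul_Gamma_eq_betaIntegral h0 (by simpa using h1),
    add_sub_cancel, Complex.Gamma_one, one_mul, Complex.betaIntegral,
    intervalIntegral.integral_of_le zero_le_one, MeasureTheory.integral_Ioc_eq_integral_Ioo]
  have himg : (fun x : ℝ => x / (1 - x)) '' Set.Ioo 0 1 = Set.Ioi 0 := by
    ext t
    constructor
    · rintro ⟨x, ⟨hx0, hx1⟩, rfl⟩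
      exact div_pos hx0 (by linarith)
    · intro ht
      have ht : 0 < t := ht
      refine ⟨t / (1 + t), ⟨by positivity, (div_lt_one (by linarith)).2 (by linarith)⟩, ?_⟩
      field_simp
      ring
  have hinj : Set.InjOn (fun x : ℝ => x / (1 - x)) (Set.Ioo 0 1) := by
    rintro x ⟨_, hx⟩ y ⟨_, hy⟩ hxy
    have h1 : 1 - x ≠ 0 := by linarith
    have h2 : 1 - y ≠ 0 := by linarith
    simp only at hxy
    rw [div_eq_div_iff h1 h2] at hxy
    linarith
  have hder : ∀ x ∈ Set.Ioo (0 : ℝ) 1, HasDerivWithinAt (fun x : ℝ => x / (1 - x))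
      (1 / (1 - x) ^ 2) (Set.Ioo 0 1) x := by
    rintro x ⟨_, hx⟩
    have h1 : 1 - x ≠ 0 := by linarith
    refine (((hasDerivAt_id x).div ((hasDerivAt_id x).const_sub 1) h1).congr_deriv
      ?_).hasDerivWithinAt
    simp
  rw [mellin, ← himg, MeasureTheory.integral_image_eq_integral_abs_deriv_smul measurableSet_Ioo
    hder hinj]
  refine MeasureTheory.setIntegral_congr_fun measurableSet_Ioo ?_
  rintro x ⟨hx0, hx1⟩
  have hx : 0 < 1 - x := by linarith
  have hxc : (1 - (x : ℂ)) ≠ 0 := by exact_mod_cast hx.ne'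
  have e1 : ((x / (1 - x) : ℝ) : ℂ) ^ (s - 1) = (x : ℂ) ^ (s - 1) / (1 - (x : ℂ)) ^ (s - 1) := by
    rw [div_eq_mul_inv, Complex.ofReal_mul, Complex.mul_cpow_ofReal_nonneg hx0.le (by positivity),
      Complex.ofReal_inv, Complex.inv_cpow, div_eq_mul_inv]
    · push_cast; rfl
    · rw [Complex.arg_ofReal_of_nonneg hx.le]; exact Real.pi_pos.ne
  have e2 : (1 - (x : ℂ)) ^ (s - 1) = (1 - (x : ℂ)) ^ s / (1 - (x : ℂ)) := by
    rw [Complex.cpow_sub _ _ hxc, Complex.cpow_one]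
  have e3 : (1 - (x : ℂ)) ^ (1 - s - 1) = ((1 - (x : ℂ)) ^ s)⁻¹ := by
    rw [← Complex.cpow_neg]; congr 1; ring
  have e4 : (1 + (((x / (1 - x) : ℝ)) : ℂ))⁻¹ = 1 - x := by
    push_cast
    field_simp
    ring
  have e5 : (1 - (x : ℂ)) ^ s ≠ 0 := by
    rw [Complex.cpow_ne_zero_iff]; exact Or.inl hxc
  simp only
  rw [e1, e2, e3, e4, abs_of_pos (by positivity), Complex.real_smul, smul_eq_mul]
  push_cast
  field_simp

/-- For `u > 0` this is a rescaling of `t`. Both sides are holomorphic on the slit plane and agree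
at the points `1 + 1/(n+1)`, which accumulate at `1`. -/
theorem mellin_one_add_mul_inv {s : ℂ} (h0 : 0 < s.re) (h1 : s.re < 1) {u : ℂ}
    (hu : u ∈ Complex.slitPlane) :
    mellin (fun t : ℝ => (1 + u * (t : ℂ))⁻¹) s =
      u ^ (-s) * (Real.pi / Complex.sin (Real.pi * s)) := by
  have hA : AnalyticOnNhd ℂ (fun u => mellin (fun t : ℝ => (1 + u * (t : ℂ))⁻¹) s)
      Complex.slitPlane := DifferentiableOn.analyticOnNhd
    (fun u hu => (differentiableAt_mellin_one_add_mul_inv h0 h1 hu).differentiableWithinAt)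
    Complex.isOpen_slitPlane
  have hB : AnalyticOnNhd ℂ (fun u => u ^ (-s) * (Real.pi / Complex.sin (Real.pi * s)))
      Complex.slitPlane := fun u hu =>
    (analyticAt_id.cpow analyticAt_const hu).mul analyticAt_const
  refine hA.eqOn_of_preconnected_of_frequently_eq hB
    (Complex.starConvex_one_slitPlane.isPathConnected Complex.one_mem_slitPlane).isConnected.isPreconnected
    Complex.one_mem_slitPlane ?_ hu
  have hpos : ∀ r : ℝ, 0 < r → mellin (fun t : ℝ => (1 + (r : ℂ) * (t : ℂ))⁻¹) s =
      (r : ℂ) ^ (-s) * (Real.pi / Complex.sin (Real.pi * s)) := by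
    intro r hr
    rw [← mellin_one_add_inv h0 h1, ← smul_eq_mul, ← mellin_comp_mul_left _ _ hr]
    simp
  have hseq : Tendsto (fun n : ℕ => ((1 + 1 / ((n : ℝ) + 1) : ℝ) : ℂ)) atTop (𝓝[≠] 1) := by
    refine tendsto_nhdsWithin_iff.2 ⟨?_, Eventually.of_forall fun n => ?_⟩
    · have : Tendsto (fun n : ℕ => (1 + 1 / ((n : ℝ) + 1) : ℝ)) atTop (𝓝 (1 + 0)) :=
        tendsto_one_div_add_atTop_nhds_zero_nat.const_add 1
      rw [add_zero] at this
      have h := (Complex.continuous_ofReal.tendsto 1).comp this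
      rwa [Complex.ofReal_one] at h
    · simp only [Set.mem_compl_iff, Set.mem_singleton_iff]
      have : (0 : ℝ) < 1 / ((n : ℝ) + 1) := by positivity
      intro h
      have h' : (1 + 1 / ((n : ℝ) + 1) : ℝ) = 1 := by exact_mod_cast h
      linarith
  exact hseq.frequently (Eventually.of_forall fun n => hpos _ (by positivity)).frequently

/-! ### Convergence of the zeta series and geometry of the sector. -/

namespace IsZetaSequence

variable {a : ℕ → ℂ} {Ψ ε α : ℝ}

theorem exponent_nonneg (hS : IsZetaSequence a Ψ ε α) : 0 ≤ α := by
  have h : ((0 : ℝ) : EReal) ≤ (α : EReal) := by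
    rw [← hS.exponent]
    refine le_limsup_of_frequently_le' (Eventually.frequently ?_)
    filter_upwards [hS.norm_tendsto.eventually_gt_atTop 1] with n hn
    have h1 : (1 : ℝ) ≤ (n : ℝ) + 1 := by linarith [n.cast_nonneg (α := ℝ)]
    exact EReal.coe_le_coe_iff.2 (div_nonneg (Real.log_nonneg h1) (Real.log_nonneg hn.le))
  exact_mod_cast h

/-- For `α < τ < σ` one has eventually `ln (n + 1) < τ ln ‖a n‖`, hence `‖a n‖^{-σ} ≤ (n +
1)^{-σ/τ}` with `σ / τ > 1`. -/
theorem summable_rpow_neg (hS : IsZetaSequence a Ψ ε α) {σ : ℝ} (hσ : α < σ) :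
    Summable fun n => ‖a n‖ ^ (-σ) := by
  obtain ⟨τ, h1, h2⟩ := exists_between hσ
  have hτ : 0 < τ := hS.exponent_nonneg.trans_lt h1
  have hlim : ∀ᶠ n : ℕ in atTop,
      ((Real.log ((n : ℝ) + 1) / Real.log ‖a n‖ : ℝ) : EReal) < (τ : EReal) := by
    refine eventually_lt_of_limsup_lt ?_
    rw [hS.exponent]
    exact_mod_cast h1
  have hsum : Summable fun n : ℕ => ((n : ℝ) + 1) ^ (-(σ / τ)) := by
    have := (summable_nat_add_iff 1).2
      (Real.summable_nat_rpow.2 (neg_lt_neg ((one_lt_div hτ).2 h2)))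
    simpa using this
  refine hsum.of_norm_bounded_eventually_nat ?_
  filter_upwards [hlim, hS.norm_tendsto.eventually_gt_atTop 1] with n hn hn1
  have hn' : Real.log ((n : ℝ) + 1) / Real.log ‖a n‖ < τ := by exact_mod_cast hn
  rw [div_lt_iff₀ (Real.log_pos hn1)] at hn'
  have hpos : 0 < ‖a n‖ := by linarith
  have hn0 : (0 : ℝ) < n + 1 := by positivity
  rw [Real.norm_of_nonneg (by positivity), Real.rpow_def_of_pos hpos, Real.rpow_def_of_pos hn0]
  refine Real.exp_le_exp.2 ?_
  have : Real.log ((n : ℝ) + 1) * (σ / τ) ≤ Real.log ‖a n‖ * σ := by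
    rw [mul_div_assoc', div_le_iff₀ hτ]
    nlinarith
  linarith

/-- A larger `ε` would make the sector the whole punctured plane. -/
theorem eps_le_pi (hS : IsZetaSequence a Ψ ε α) : ε ≤ Real.pi := by
  have h := hS.avoids 0
  simp only [sector, Set.mem_ofPred_eq, not_and, not_lt] at h
  exact (h (hS.ne_zero 0)).trans (Complex.abs_arg_le_pi _)

end IsZetaSequence

/-- The number `u` with `1 - t e^{iΨ} / z = 1 + u t`. -/
noncomputable def rayFactor (Ψ : ℝ) (z : ℂ) : ℂ := -(z * Complex.exp (-(Ψ : ℂ) * Complex.I))⁻¹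

theorem norm_rayFactor (Ψ : ℝ) (z : ℂ) : ‖rayFactor Ψ z‖ = ‖z‖⁻¹ := by
  have : ‖Complex.exp (-(Ψ : ℂ) * Complex.I)‖ = 1 := by
    rw [← Complex.ofReal_neg, Complex.norm_exp_ofReal_mul_I]
  rw [rayFactor, norm_neg, norm_inv, norm_mul, this, mul_one]

theorem rayFactor_mul (Ψ : ℝ) {z : ℂ} (hz : z ≠ 0) :
    rayFactor Ψ z * z = -Complex.exp (Ψ * Complex.I) := by
  rw [rayFactor, neg_mul (Ψ : ℂ), Complex.exp_neg]
  have := Complex.exp_ne_zero (Ψ * Complex.I)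
  field_simp

/-- Outside the sector, `u / ‖u‖` lies in the compact arc `Re ≥ -cos ε` of the unit circle, which
misses `-1`. After rescaling `t` by `‖u‖`, the compactness bound holds with one constant for all
`z`. -/
theorem exists_rayFactor_bound {Ψ ε : ℝ} (hε : 0 < ε) (hεπ : ε ≤ Real.pi) :
    ∃ c : ℝ, 0 < c ∧ ∀ z : ℂ, z ≠ 0 → z ∉ sector Ψ ε → rayFactor Ψ z ∈ Complex.slitPlane ∧
      ∀ t : ℝ, 0 ≤ t → c * (1 + ‖rayFactor Ψ z‖ * t) ≤ ‖1 + rayFactor Ψ z * t‖ := by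
  set K : Set ℂ := Metric.sphere 0 1 ∩ {v | -Real.cos ε ≤ v.re}
  have hcos : -1 < -Real.cos ε := by
    have : Real.cos ε < Real.cos 0 :=
      Real.cos_lt_cos_of_nonneg_of_le_pi le_rfl hεπ hε
    rw [Real.cos_zero] at this
    linarith
  have hK : IsCompact K := (isCompact_sphere 0 1).inter_right
    (isClosed_le continuous_const Complex.continuous_re)
  have hKs : K ⊆ Complex.slitPlane := by
    rintro v ⟨hv1, hv2⟩
    rw [mem_sphere_zero_iff_norm] at hv1
    rw [Complex.mem_slitPlane_iff]
    by_contra! hcon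
    have : |v.re| = 1 := by rw [← hv1, Complex.abs_re_eq_norm]; exact hcon.2
    rw [abs_of_nonpos hcon.1] at this
    simp only [Set.mem_ofPred_eq] at hv2
    linarith
  obtain ⟨c, hc, hb⟩ := exists_mul_one_add_le_norm_one_add_mul hK hKs
  refine ⟨c, hc, fun z hz hzs => ?_⟩
  set w := z * Complex.exp (-(Ψ : ℂ) * Complex.I) with hw
  have hw0 : w ≠ 0 := mul_ne_zero hz (Complex.exp_ne_zero _)
  have harg : ε ≤ |Complex.arg w| := by
    simp only [sector, Set.mem_ofPred_eq, not_and, not_lt] at hzs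
    exact hzs hz
  have hwre : w.re ≤ ‖w‖ * Real.cos ε := by
    rw [← Complex.norm_mul_cos_arg w, ← Real.cos_abs (Complex.arg w)]
    gcongr
    exact Real.cos_le_cos_of_nonneg_of_le_pi hε.le (Complex.abs_arg_le_pi w) harg
  set u := rayFactor Ψ z with hu
  have hu' : u = -w⁻¹ := rfl
  have hu0 : u ≠ 0 := by rw [hu']; exact neg_ne_zero.2 (inv_ne_zero hw0)
  have hun : 0 < ‖u‖ := norm_pos_iff.2 hu0
  have hwn : 0 < ‖w‖ := norm_pos_iff.2 hw0
  have hunw : ‖u‖ = ‖w‖⁻¹ := by rw [hu', norm_neg, norm_inv]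
  have hv : ((‖u‖⁻¹ : ℝ) : ℂ) * u ∈ K := by
    constructor
    · rw [mem_sphere_zero_iff_norm, norm_mul, Complex.norm_real, norm_inv, norm_norm,
        inv_mul_cancel₀ hun.ne']
    · rw [Set.mem_ofPred_eq, Complex.re_ofReal_mul, hunw, inv_inv, hu', Complex.neg_re,
        Complex.inv_re, Complex.normSq_eq_norm_sq, mul_neg, neg_le_neg_iff]
      rw [show ‖w‖ * (w.re / ‖w‖ ^ 2) = w.re / ‖w‖ by field_simp, div_le_iff₀ hwn, mul_comm]
      exact hwre
  have huv : u = ((‖u‖ : ℝ) : ℂ) * (((‖u‖⁻¹ : ℝ) : ℂ) * u) := by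
    have : ((‖u‖ : ℝ) : ℂ) ≠ 0 := by exact_mod_cast hun.ne'
    push_cast
    field_simp
  constructor
  · have := hKs hv
    rw [Complex.mem_slitPlane_iff] at this ⊢
    rw [Complex.re_ofReal_mul, Complex.im_ofReal_mul] at this
    rcases this with h | h
    · exact Or.inl (pos_of_mul_pos_right h (by positivity))
    · exact Or.inr (right_ne_zero_of_mul h)
  · intro t ht
    have := hb _ hv (‖u‖ * t) (by positivity)
    convert this using 2
    conv_lhs => rw [huv]
    push_cast
    ring

/-- The inverse of `u` is `z e^{-i(Ψ - π)}`, whose principal logarithm is the one used by `cutPow`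
up to the shift `i(Ψ - π)`. Membership in the slit plane gives `log u⁻¹ = -log u`. -/
theorem rayFactor_cpow {Ψ : ℝ} {z : ℂ} (hs : rayFactor Ψ z ∈ Complex.slitPlane)
    (s : ℂ) : rayFactor Ψ z ^ s =
      Complex.exp (s * ((Ψ - Real.pi : ℝ) * Complex.I)) * cutPow Ψ z (-s) := by
  have h0 : rayFactor Ψ z ≠ 0 := Complex.slitPlane_ne_zero hs
  have h1 : z * Complex.exp (-((Ψ - Real.pi : ℝ) : ℂ) * Complex.I) = (rayFactor Ψ z)⁻¹ := by
    have : -((Ψ - Real.pi : ℝ) : ℂ) * Complex.I = -(Ψ : ℂ) * Complex.I + Real.pi * Complex.I := by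
      push_cast; ring
    rw [this, Complex.exp_add, Complex.exp_pi_mul_I, rayFactor, inv_neg, inv_inv]
    ring
  rw [Complex.cpow_def_of_ne_zero h0, cutPow, logAround, h1,
    Complex.log_inv _ (Complex.slitPlane_arg_ne_pi hs), ← Complex.exp_add]
  congr 1
  ring

theorem norm_cutPow_le (Ψ : ℝ) {z : ℂ} (hz : z ≠ 0) (s : ℂ) :
    ‖cutPow Ψ z s‖ ≤ ‖z‖ ^ s.re * Real.exp (|s.im| * (2 * Real.pi + |Ψ|)) := by
  rw [cutPow, Complex.norm_exp, Real.rpow_def_of_pos (norm_pos_iff.2 hz), ← Real.exp_add]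
  refine Real.exp_le_exp.2 ?_
  have hn : ‖Complex.exp (-((Ψ - Real.pi : ℝ) : ℂ) * Complex.I)‖ = 1 := by
    rw [← Complex.ofReal_neg, Complex.norm_exp_ofReal_mul_I]
  have hre : (logAround (Ψ - Real.pi) z).re = Real.log ‖z‖ := by
    rw [logAround, Complex.add_re, Complex.log_re, norm_mul, hn]
    simp
  have him : |(logAround (Ψ - Real.pi) z).im| ≤ 2 * Real.pi + |Ψ| := by
    rw [logAround, Complex.add_im, Complex.log_im]
    simp only [Complex.mul_im, Complex.ofReal_re, Complex.I_im, mul_one, Complex.ofReal_im,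
      Complex.I_re, mul_zero, add_zero]
    have h1 := Complex.abs_arg_le_pi (z * Complex.exp (-((Ψ - Real.pi : ℝ) : ℂ) * Complex.I))
    have h2 := abs_add_le (Complex.arg (z * Complex.exp (-((Ψ - Real.pi : ℝ) : ℂ) * Complex.I)))
      (Ψ - Real.pi)
    have h3 := abs_sub Ψ Real.pi
    rw [abs_of_pos Real.pi_pos] at h3
    linarith
  rw [Complex.mul_re, hre]
  have h4 : -(s.im * (logAround (Ψ - Real.pi) z).im) ≤ |s.im| * (2 * Real.pi + |Ψ|) := by
    refine (neg_le_abs _).trans ?_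
    rw [abs_mul]
    gcongr
  linarith

theorem differentiable_cutPow_neg (Ψ : ℝ) (z : ℂ) : Differentiable ℂ fun s => cutPow Ψ z (-s) := by
  unfold cutPow
  fun_prop

namespace IsZetaSequence

variable {a : ℕ → ℂ} {Ψ ε α : ℝ}

theorem summable_cutPow (hS : IsZetaSequence a Ψ ε α) {s : ℂ} (hs : α < s.re) :
    Summable fun n => cutPow Ψ (a n) (-s) := by
  refine Summable.of_norm_bounded ((hS.summable_rpow_neg hs).mul_right _)
    fun n => norm_cutPow_le Ψ (hS.ne_zero n) (-s)

theorem differentiableAt_tsum_cutPow (hS : IsZetaSequence a Ψ ε α) {s : ℂ} (hs : α < s.re) :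
    DifferentiableAt ℂ (fun s => ∑' n, cutPow Ψ (a n) (-s)) s := by
  obtain ⟨σ, h1, h2⟩ := exists_between hs
  set U : Set ℂ := {w | σ < w.re} ∩ {w | w.re < s.re + 1} ∩ {w | |w.im| < |s.im| + 1}
  have hU : IsOpen U := ((isOpen_lt continuous_const Complex.continuous_re).inter
    (isOpen_lt Complex.continuous_re continuous_const)).inter
    (isOpen_lt (continuous_abs.comp Complex.continuous_im) continuous_const)
  have hsU : s ∈ U := ⟨⟨h2, by simp⟩, by simp⟩
  -- Two powers in the majorant: the first covers terms with `‖a n‖ ≥ 1`, the second those with `‖a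
  -- n‖ ≤ 1`, for which an upper bound on `Re w` is needed.
  refine (Complex.differentiableOn_tsum_of_summable_norm
    (u := fun n => (‖a n‖ ^ (-σ) + ‖a n‖ ^ (-(s.re + 1))) *
      Real.exp ((|s.im| + 1) * (2 * Real.pi + |Ψ|)))
    (((hS.summable_rpow_neg h1).add (hS.summable_rpow_neg (by linarith))).mul_right _)
    (fun n => (differentiable_cutPow_neg Ψ (a n)).differentiableOn) hU ?_).differentiableAt
    (hU.mem_nhds hsU)
  rintro n w ⟨⟨hw1, hw2⟩, hw3⟩
  simp only [Set.mem_ofPred_eq] at hw1 hw2 hw3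
  refine (norm_cutPow_le Ψ (hS.ne_zero n) (-w)).trans ?_
  have hpos : 0 < ‖a n‖ := norm_pos_iff.2 (hS.ne_zero n)
  rw [Complex.neg_re, Complex.neg_im, abs_neg]
  gcongr
  rcases le_total 1 ‖a n‖ with h | h
  · have := Real.rpow_le_rpow_of_exponent_le h (show -w.re ≤ -σ by linarith)
    have := Real.rpow_nonneg hpos.le (-(s.re + 1))
    linarith
  · have := Real.rpow_le_rpow_of_exponent_ge hpos h (show -(s.re + 1) ≤ -w.re by linarith)
    have := Real.rpow_nonneg hpos.le (-σ)
    linarith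

end IsZetaSequence

/-! ### The logarithmic derivative along the ray and its Mellin transform. -/

/-- The derivative along the ray of argument `Ψ` of `ln F` minus its Taylor polynomial of
degree `p`. -/
noncomputable def rayTail (F : ℂ → ℂ) (Ψ : ℝ) (p : ℕ) (t : ℝ) : ℂ :=
  Complex.exp (Ψ * Complex.I) * (t * Complex.exp (Ψ * Complex.I)) ^ p *
    taylorTail p (logDeriv F) (t * Complex.exp (Ψ * Complex.I))

theorem ray_mul_exp_neg (Ψ t : ℝ) :
    (t * Complex.exp (Ψ * Complex.I)) * Complex.exp (-(Ψ : ℂ) * Complex.I) = t := by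
  rw [mul_assoc, ← Complex.exp_add]
  simp

theorem ray_mem_sector {Ψ ε t : ℝ} (hε : 0 < ε) (ht : 0 < t) :
    (t * Complex.exp (Ψ * Complex.I)) ∈ sector Ψ ε := by
  refine ⟨mul_ne_zero (by exact_mod_cast ht.ne') (Complex.exp_ne_zero _), ?_⟩
  rw [ray_mul_exp_neg, Complex.arg_ofReal_of_nonneg ht.le, abs_zero]
  exact hε

theorem sector_mem_nhds_ray {Ψ ε t : ℝ} (hε : 0 < ε) (ht : 0 < t) :
    sector Ψ ε ∈ 𝓝 (t * Complex.exp (Ψ * Complex.I)) := by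
  have h1 : ContinuousAt (fun z : ℂ => |Complex.arg (z * Complex.exp (-(Ψ : ℂ) * Complex.I))|)
      (t * Complex.exp (Ψ * Complex.I)) := by
    have h2 : ContinuousAt (fun z : ℂ => z * Complex.exp (-(Ψ : ℂ) * Complex.I))
      (t * Complex.exp (Ψ * Complex.I)) := by fun_prop
    refine (ContinuousAt.comp' ?_ h2).abs
    rw [ray_mul_exp_neg]
    exact Complex.continuousAt_arg (by simpa using ht)
  have h2 := (ray_mem_sector (Ψ := Ψ) hε ht)
  filter_upwards [h1.eventually_lt continuousAt_const h2.2,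
    isOpen_ne.mem_nhds h2.1] with z hz hz0 using ⟨hz0, hz⟩

section

variable {a : ℕ → ℂ} {Ψ ε α : ℝ} {F : ℂ → ℂ}

theorem IsCharacteristicFunction.ne_zero_of_forall_ne (hF : IsCharacteristicFunction a α F) {z : ℂ}
    (hz : ∀ n, a n ≠ z) : F z ≠ 0 := by
  rw [← (hF.entire.analyticAt z).analyticOrderAt_eq_zero, hF.zeros, Set.encard_eq_zero,
    Set.eq_empty_iff_forall_notMem]
  exact fun k hk => hz k hk

theorem IsCharacteristicFunction.apply_zero_ne_zero (hS : IsZetaSequence a Ψ ε α)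
    (hF : IsCharacteristicFunction a α F) : F 0 ≠ 0 :=
  hF.ne_zero_of_forall_ne hS.ne_zero

theorem IsCharacteristicFunction.ne_zero_of_mem_sector (hS : IsZetaSequence a Ψ ε α)
    (hF : IsCharacteristicFunction a α F) {z : ℂ} (hz : z ∈ sector Ψ ε) : F z ≠ 0 :=
  hF.ne_zero_of_forall_ne fun n h => hS.avoids n (h ▸ hz)

theorem IsZetaSequence.exists_rayFactor_bound (hS : IsZetaSequence a Ψ ε α) :
    ∃ c : ℝ, 0 < c ∧ ∀ n, rayFactor Ψ (a n) ∈ Complex.slitPlane ∧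
      ∀ t : ℝ, 0 ≤ t → c * (1 + ‖rayFactor Ψ (a n)‖ * t) ≤ ‖1 + rayFactor Ψ (a n) * t‖ := by
  obtain ⟨c, hc, h⟩ := _root_.exists_rayFactor_bound (Ψ := Ψ) hS.eps_pos hS.eps_le_pi
  exact ⟨c, hc, fun n => h (a n) (hS.ne_zero n) (hS.avoids n)⟩

theorem IsZetaSequence.rayFactor_mem_slitPlane (hS : IsZetaSequence a Ψ ε α) (n : ℕ) :
    rayFactor Ψ (a n) ∈ Complex.slitPlane := by
  obtain ⟨c, -, h⟩ := hS.exists_rayFactor_bound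
  exact (h n).1

theorem IsZetaSequence.summable_rayFactor (hS : IsZetaSequence a Ψ ε α) {σ : ℝ} (hσ : α < σ) :
    Summable fun n => ‖rayFactor Ψ (a n)‖ ^ σ := by
  convert hS.summable_rpow_neg hσ using 2 with n
  rw [norm_rayFactor, Real.inv_rpow (norm_nonneg _), Real.rpow_neg (norm_nonneg _)]

/-- The terms of the partial fraction expansion of `rayTail`. -/
noncomputable def rayTerm (a : ℕ → ℂ) (Ψ : ℝ) (p n : ℕ) (t : ℝ) : ℂ :=
  (-1) ^ p * rayFactor Ψ (a n) ^ (p + 1) * (t : ℂ) ^ p * (1 + rayFactor Ψ (a n) * t)⁻¹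

/-- From `x^θ ≤ 1 + x` for `0 ≤ θ ≤ 1`, with `x = ‖u‖ t` and `θ = p + 1 - σ`. The free parameter
matters: `σ = p + 1` controls `t → 0`, and `σ` close to `α` controls `t → ∞`. -/
theorem IsZetaSequence.exists_norm_rayTerm_le (hS : IsZetaSequence a Ψ ε α) (p : ℕ) :
    ∃ C : ℝ, 0 < C ∧ ∀ σ : ℝ, p ≤ σ → σ ≤ p + 1 → ∀ n, ∀ t : ℝ, 0 < t →
      ‖rayTerm a Ψ p n t‖ ≤ C * ‖rayFactor Ψ (a n)‖ ^ σ * t ^ (σ - 1) := by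
  obtain ⟨c, hc, h⟩ := hS.exists_rayFactor_bound
  refine ⟨c⁻¹, by positivity, fun σ h1 h2 n t ht => ?_⟩
  have hb := (h n).2 t ht.le
  set r := ‖rayFactor Ψ (a n)‖ with hr
  have hr0 : 0 < r := norm_pos_iff.2 (Complex.slitPlane_ne_zero (h n).1)
  have hx : 0 < r * t := by positivity
  have h3 : (r * t) ^ (p + 1 - σ) ≤ 1 + r * t := by
    rcases le_total 1 (r * t) with h | h
    · have := Real.rpow_le_rpow_of_exponent_le h (show p + 1 - σ ≤ 1 by linarith)
      rw [Real.rpow_one] at this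
      linarith
    · have := Real.rpow_le_one hx.le h (show 0 ≤ p + 1 - σ by linarith)
      linarith
  have h4 : c * (r * t) ^ (p + 1 - σ) ≤ ‖1 + rayFactor Ψ (a n) * t‖ :=
    (mul_le_mul_of_nonneg_left h3 hc.le).trans hb
  have h5 : 0 < c * (r * t) ^ (p + 1 - σ) := mul_pos hc (Real.rpow_pos_of_pos hx _)
  rw [rayTerm, norm_mul, norm_mul, norm_mul, norm_pow, norm_pow, norm_neg, norm_one, one_pow,
    one_mul, norm_inv, norm_pow, ← hr, Complex.norm_real, Real.norm_of_nonneg ht.le]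
  calc r ^ (p + 1) * t ^ p * ‖1 + rayFactor Ψ (a n) * t‖⁻¹
      ≤ r ^ (p + 1) * t ^ p * (c * (r * t) ^ (p + 1 - σ))⁻¹ := by gcongr
    _ = _ := by
      rw [Real.mul_rpow hr0.le ht.le]
      have e1 : r ^ (p + 1 - σ) = r ^ (p + 1) / r ^ σ := by
        rw [Real.rpow_sub hr0]; norm_cast
      have e2 : t ^ (p + 1 - σ) = t ^ p / t ^ (σ - 1) := by
        rw [show (p : ℝ) + 1 - σ = p - (σ - 1) by ring, Real.rpow_sub ht]; norm_cast
      rw [e1, e2]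
      have := Real.rpow_pos_of_pos hr0 σ
      have := Real.rpow_pos_of_pos ht (σ - 1)
      field_simp

/-- The partial fraction theorem gives convergence of the ordered partial sums at `z = t e^{iΨ}`;
absolute summability upgrades it to `HasSum`. -/
theorem hasSum_rayTail (hS : IsZetaSequence a Ψ ε α) (hF : IsCharacteristicFunction a α F) {p : ℕ}
    (hp : α < p + 1) {t : ℝ} (ht : 0 < t) :
    HasSum (fun n => rayTerm a Ψ p n t) (rayTail F Ψ p t) := by
  obtain ⟨C, -, hC⟩ := hS.exists_norm_rayTerm_le p
  have hsum : Summable fun n => rayTerm a Ψ p n t :=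
    Summable.of_norm_bounded (((hS.summable_rayFactor hp).mul_left C).mul_right _)
      fun n => hC _ (by linarith) le_rfl n t ht
  obtain ⟨β, h1, h2⟩ := exists_between hp
  have hβ : 0 < β := hS.exponent_nonneg.trans_lt h1
  have hlim := tendsto_sum_taylorTail_logDeriv hS.ne_zero hS.norm_mono hS.norm_tendsto hF.entire
    hF.zeros (isBigO_exp_rpow_of_growthOrder_lt hF.order hβ h1) h2
    (hF.ne_zero_of_mem_sector hS (ray_mem_sector hS.eps_pos ht))
  have hlim2 := hlim.const_mul
    (Complex.exp (Ψ * Complex.I) * (t * Complex.exp (Ψ * Complex.I)) ^ p)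
  have heq : ∀ n, rayTerm a Ψ p n t =
      (Complex.exp (Ψ * Complex.I) * (t * Complex.exp (Ψ * Complex.I)) ^ p) *
        (((a n)⁻¹) ^ p * (t * Complex.exp (Ψ * Complex.I) - a n)⁻¹) := by
    intro n
    have ha := hS.ne_zero n
    have hE : Complex.exp (Ψ * Complex.I) = -(rayFactor Ψ (a n) * a n) := by
      rw [rayFactor_mul Ψ ha, neg_neg]
    have hne := one_add_mul_ne_zero_of_mem_slitPlane (hS.rayFactor_mem_slitPlane n) ht.le
    have hne2 : (t * -(rayFactor Ψ (a n) * a n) - a n) =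
        -(a n) * (1 + rayFactor Ψ (a n) * t) := by ring
    rw [rayTerm, hE, hne2]
    have e : (t * -(rayFactor Ψ (a n) * a n)) ^ p * ((a n)⁻¹) ^ p =
        (-1) ^ p * rayFactor Ψ (a n) ^ p * t ^ p := by
      rw [← mul_pow, ← mul_pow, ← mul_pow]
      congr 1
      field_simp
    rw [mul_assoc (-(rayFactor Ψ (a n) * a n)), ← mul_assoc ((_ : ℂ) ^ p), e, mul_inv]
    rw [pow_succ]
    field_simp
  have := tendsto_nhds_unique hsum.hasSum.tendsto_sum_nat
    (hlim2.congr fun n => by rw [Finset.mul_sum]; exact (Finset.sum_congr rfl fun k _ => (heq k).symm))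
  rw [rayTail, ← this]
  exact hsum.hasSum

theorem exists_norm_rayTail_le (hS : IsZetaSequence a Ψ ε α) (hF : IsCharacteristicFunction a α F)
    {p : ℕ} {σ : ℝ} (h0 : α < σ) (h1 : p ≤ σ) (h2 : σ ≤ p + 1) :
    ∃ C : ℝ, ∀ t : ℝ, 0 < t → ‖rayTail F Ψ p t‖ ≤ C * t ^ (σ - 1) := by
  obtain ⟨C, -, hC⟩ := hS.exists_norm_rayTerm_le p
  refine ⟨(∑' n, C * ‖rayFactor Ψ (a n)‖ ^ σ), fun t ht => ?_⟩
  rw [← (hasSum_rayTail hS hF (by linarith) ht).tsum_eq, ← tsum_mul_right]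
  exact tsum_of_norm_bounded (((hS.summable_rayFactor h0).mul_left C).mul_right _).hasSum
    fun n => hC σ h1 h2 n t ht

theorem logDeriv_differentiableOn_ne_zero (hF : Differentiable ℂ F) :
    DifferentiableOn ℂ (logDeriv F) {z | F z ≠ 0} := by
  have hopen : IsOpen {z | F z ≠ 0} := isOpen_ne_fun hF.continuous continuous_const
  exact (hF.differentiableOn.deriv hopen).div hF.differentiableOn fun z hz => hz

theorem continuousOn_rayTail (hS : IsZetaSequence a Ψ ε α) (hF : IsCharacteristicFunction a α F)
    (p : ℕ) : ContinuousOn (rayTail F Ψ p) (Set.Ioi 0) := by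
  have hnhds : {z | F z ≠ 0} ∈ 𝓝 (0 : ℂ) :=
    hF.entire.continuous.continuousAt.eventually_ne (hF.apply_zero_ne_zero hS)
  have h1 := ((logDeriv_differentiableOn_ne_zero hF.entire).taylorTail hnhds p).continuousOn
  have h2 : ContinuousOn (fun t : ℝ => (t * Complex.exp (Ψ * Complex.I) : ℂ)) (Set.Ioi 0) := by
    fun_prop
  exact (continuousOn_const.mul (h2.pow p)).mul (h1.comp h2 fun t ht =>
    hF.ne_zero_of_mem_sector hS (ray_mem_sector hS.eps_pos ht))

/-- The Mellin transform of `rayTail` is the zeta function of the zeros, up to elementary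
factors. -/
theorem mellin_rayTail (hS : IsZetaSequence a Ψ ε α) (hF : IsCharacteristicFunction a α F)
    {p : ℕ} {s : ℂ} (h0 : α < s.re) (h1 : p < s.re) (h2 : s.re < p + 1) :
    mellin (rayTail F Ψ p) (1 - s) =
      Complex.exp (s * ((Ψ - Real.pi : ℝ) * Complex.I)) * (Real.pi / Complex.sin (Real.pi * s)) *
        ∑' n, cutPow Ψ (a n) (-s) := by
  obtain ⟨c, hc, hb⟩ := hS.exists_rayFactor_bound
  -- The factor `t ^ p` in `rayTerm` shifts the Mellin variable from `1 - s` to `s'`, which lies in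
  -- the strip `0 < Re s' < 1`.
  set s' : ℂ := p + 1 - s with hs'
  have hs0 : 0 < s'.re := by simp [hs']; linarith
  have hs1 : s'.re < 1 := by simp [hs']; linarith
  set u : ℕ → ℂ := fun n => rayFactor Ψ (a n) with hu
  have huslit : ∀ n, u n ∈ Complex.slitPlane := fun n => (hb n).1
  have hupos : ∀ n, 0 < ‖u n‖ := fun n => norm_pos_iff.2 (Complex.slitPlane_ne_zero (huslit n))
  have hterm : ∀ n, ∀ t : ℝ, 0 < t → (t : ℂ) ^ (1 - s - 1) • rayTerm a Ψ p n t =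
      ((-1) ^ p * u n ^ (p + 1)) * ((t : ℂ) ^ (s' - 1) • (1 + u n * (t : ℂ))⁻¹) := by
    intro n t ht
    have ht0 : (t : ℂ) ≠ 0 := by exact_mod_cast ht.ne'
    have : (t : ℂ) ^ (s' - 1) = t ^ (1 - s - 1) * (t : ℂ) ^ p := by
      rw [← Complex.cpow_natCast, ← Complex.cpow_add _ _ ht0]
      congr 1; rw [hs']; ring
    rw [rayTerm, this, smul_eq_mul, smul_eq_mul]
    ring
  have hint : ∀ n, MeasureTheory.IntegrableOn
      (fun t : ℝ => (t : ℂ) ^ (1 - s - 1) • rayTerm a Ψ p n t) (Set.Ioi 0) := fun n =>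
    MeasureTheory.IntegrableOn.congr_fun
      (MeasureTheory.Integrable.const_mul (mellinConvergent_one_add_mul_inv hs0 hs1 (huslit n)) _)
      (fun t ht => (hterm n t ht).symm) measurableSet_Ioi
  set J := ∫ t in Set.Ioi (0 : ℝ), t ^ (s'.re - 1) * (1 + t)⁻¹
  -- Rescaling `t` by `‖u n‖` extracts `‖u n‖ ^ Re s`, which is summable for `Re s > α`; this
  -- justifies exchanging sum and integral.
  have hnorm : ∀ n, ∫ t in Set.Ioi (0 : ℝ), ‖(t : ℂ) ^ (1 - s - 1) • rayTerm a Ψ p n t‖ ≤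
      c⁻¹ * J * ‖u n‖ ^ s.re := by
    intro n
    set r := ‖u n‖ with hr
    have hr0 : 0 < r := hupos n
    have e1 := MeasureTheory.integral_comp_mul_left_Ioi
      (fun t : ℝ => t ^ (s'.re - 1) * (1 + t)⁻¹) 0 hr0
    rw [mul_zero] at e1
    have hI : MeasureTheory.IntegrableOn
        (fun t : ℝ => c⁻¹ * r ^ (p + 1) * r ^ (1 - s'.re) *
          ((r * t) ^ (s'.re - 1) * (1 + r * t)⁻¹)) (Set.Ioi 0) := by
      refine MeasureTheory.Integrable.const_mul ?_ _
      have := (MeasureTheory.integrableOn_Ioi_comp_mul_left_iff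
        (fun t : ℝ => t ^ (s'.re - 1) * (1 + t)⁻¹) 0 hr0).2
      rw [mul_zero] at this
      exact this (integrableOn_rpow_mul_one_add_inv hs0 hs1)
    calc _ ≤ ∫ t in Set.Ioi (0 : ℝ), c⁻¹ * r ^ (p + 1) * r ^ (1 - s'.re) *
          ((r * t) ^ (s'.re - 1) * (1 + r * t)⁻¹) := by
          refine MeasureTheory.setIntegral_mono_on (hint n).norm hI measurableSet_Ioi
            fun t ht => ?_
          have ht : 0 < t := ht
          rw [hterm n t ht, norm_mul, norm_mul, norm_smul, norm_pow, norm_pow, norm_neg, norm_one,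
            one_pow, one_mul, norm_inv, Complex.norm_cpow_eq_rpow_re_of_pos ht, ← hr,
            Complex.sub_re, Complex.one_re]
          have h3 : ‖1 + u n * t‖⁻¹ ≤ (c * (1 + r * t))⁻¹ :=
            inv_anti₀ (by positivity) ((hb n).2 t ht.le)
          rw [Real.mul_rpow hr0.le ht.le]
          have h4 : r ^ (1 - s'.re) * r ^ (s'.re - 1) = 1 := by
            rw [← Real.rpow_add hr0]; simp
          calc r ^ (p + 1) * (t ^ (s'.re - 1) * ‖1 + u n * t‖⁻¹)
              ≤ r ^ (p + 1) * (t ^ (s'.re - 1) * (c * (1 + r * t))⁻¹) := by gcongr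
            _ = c⁻¹ * r ^ (p + 1) * (r ^ (1 - s'.re) * r ^ (s'.re - 1)) *
                (t ^ (s'.re - 1) * (1 + r * t)⁻¹) := by rw [h4, mul_inv]; ring
            _ = _ := by ring
      _ = c⁻¹ * J * r ^ s.re := by
          rw [MeasureTheory.integral_const_mul, e1, smul_eq_mul]
          have h5 : r ^ s.re = r ^ (p + 1) * r ^ (1 - s'.re) * r⁻¹ := by
            rw [← Real.rpow_natCast, ← Real.rpow_add hr0, ← Real.rpow_neg_one,
              ← Real.rpow_add hr0]
            congr 1
            simp [hs']
            ring
          rw [h5]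
          ring
  have hsummable : Summable fun n =>
      ∫ t in Set.Ioi (0 : ℝ), ‖(t : ℂ) ^ (1 - s - 1) • rayTerm a Ψ p n t‖ :=
    Summable.of_nonneg_of_le (fun n => MeasureTheory.integral_nonneg fun t => norm_nonneg _) hnorm
      ((hS.summable_rayFactor h0).mul_left _)
  have hmain := MeasureTheory.hasSum_integral_of_summable_integral_norm hint hsummable
  have hL : ∫ t in Set.Ioi (0 : ℝ), ∑' n, (t : ℂ) ^ (1 - s - 1) • rayTerm a Ψ p n t =
      mellin (rayTail F Ψ p) (1 - s) := by
    rw [mellin]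
    refine MeasureTheory.setIntegral_congr_fun measurableSet_Ioi fun t ht => ?_
    have ht : 0 < t := ht
    have h := hasSum_rayTail hS hF (h0.trans h2) ht
    exact (h.const_smul ((t : ℂ) ^ (1 - s - 1))).tsum_eq
  rw [← hL, ← hmain.tsum_eq, ← tsum_mul_left]
  congr 1
  ext n
  have h3 : ∫ t in Set.Ioi (0 : ℝ), (t : ℂ) ^ (1 - s - 1) • rayTerm a Ψ p n t =
      ((-1) ^ p * u n ^ (p + 1)) * mellin (fun t : ℝ => (1 + u n * (t : ℂ))⁻¹) s' := by
    rw [mellin, ← MeasureTheory.integral_const_mul]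
    exact MeasureTheory.setIntegral_congr_fun measurableSet_Ioi fun t ht => hterm n t ht
  have h4 : Complex.sin (Real.pi * s') = (-1) ^ p * Complex.sin (Real.pi * s) := by
    rw [hs', show (Real.pi : ℂ) * (p + 1 - s) = (Real.pi - Real.pi * s) + p * Real.pi by ring,
      Complex.sin_antiperiodic.add_nat_mul_eq, Complex.sin_pi_sub]
  have hu0 := Complex.slitPlane_ne_zero (huslit n)
  have h5 : u n ^ (p + 1) * u n ^ (-s') = u n ^ s := by
    rw [← Complex.cpow_natCast, ← Complex.cpow_add _ _ hu0]
    congr 1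
    push_cast
    rw [hs']
    ring
  have h6 : ((-1 : ℂ) ^ p) * ((-1) ^ p)⁻¹ = 1 := mul_inv_cancel₀ (by simp)
  rw [h3, mellin_one_add_mul_inv hs0 hs1 (huslit n), h4,
    mul_right_comm (Complex.exp _), ← rayFactor_cpow (huslit n) s, ← h5, div_eq_mul_inv, div_eq_mul_inv, mul_inv]
  linear_combination (u n ^ (p + 1) * u n ^ (-s') * Real.pi * (Complex.sin (Real.pi * s))⁻¹) * h6

end

/-! ### The pole functions produced by powers and logarithms. -/

/-- The logarithm of `t e^{iΨ}`. -/
noncomputable def rayLog (Ψ t : ℝ) : ℂ := Real.log t + Ψ * Complex.I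

theorem logAround_ray (Ψ : ℝ) {t : ℝ} (ht : 0 < t) :
    logAround Ψ (t * Complex.exp (Ψ * Complex.I)) = rayLog Ψ t := by
  rw [logAround, ray_mul_exp_neg, rayLog, Complex.ofReal_log ht.le]

theorem hasDerivAt_rayLog (Ψ : ℝ) {t : ℝ} (ht : 0 < t) :
    HasDerivAt (rayLog Ψ) (t : ℂ)⁻¹ t := by
  have := ((Real.hasDerivAt_log ht.ne').ofReal_comp).add_const (Ψ * Complex.I)
  rwa [Complex.ofReal_inv] at this

theorem exp_mul_rayLog (Ψ : ℝ) {t : ℝ} (ht : 0 < t) (w : ℂ) :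
    Complex.exp (w * rayLog Ψ t) = Complex.exp (w * (Ψ * Complex.I)) * (t : ℂ) ^ w := by
  rw [rayLog, Complex.cpow_def_of_ne_zero (by exact_mod_cast ht.ne'), ← Complex.ofReal_log ht.le,
    ← Complex.exp_add]
  congr 1
  ring

theorem norm_exp_mul_rayLog (Ψ : ℝ) {t : ℝ} (ht : 0 < t) (w : ℂ) :
    ‖Complex.exp (w * rayLog Ψ t)‖ = ‖Complex.exp (w * (Ψ * Complex.I))‖ * t ^ w.re := by
  rw [exp_mul_rayLog Ψ ht, norm_mul, Complex.norm_cpow_eq_rpow_re_of_pos ht]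

theorem continuousOn_rayLog (Ψ : ℝ) : ContinuousOn (rayLog Ψ) (Set.Ioi 0) := fun _ ht =>
  (hasDerivAt_rayLog Ψ ht).continuousAt.continuousWithinAt

theorem isBigO_rayLog_pow (Ψ : ℝ) (k : ℕ) {η : ℝ} (hη : 0 < η) :
    (fun t => rayLog Ψ t ^ k) =O[atTop] fun t : ℝ => t ^ η := by
  have h1 : rayLog Ψ =O[atTop] Real.log := by
    refine IsBigO.add (IsBigO.of_bound 1 (Eventually.of_forall fun t => ?_)) ?_
    · rw [Complex.norm_real, one_mul]
    · exact (isLittleO_const_left.2 (Or.inr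
        (tendsto_norm_atTop_atTop.comp Real.tendsto_log_atTop))).isBigO
  refine (h1.pow k).trans ?_
  have := (isLittleO_log_rpow_rpow_atTop (k : ℝ) hη).isBigO
  simpa using this

theorem isBigO_exp_mul_rayLog_mul_pow (Ψ : ℝ) (k : ℕ) (w : ℂ) {σ : ℝ} (hσ : w.re < σ) :
    (fun t => Complex.exp (w * rayLog Ψ t) * rayLog Ψ t ^ k) =O[atTop] fun t : ℝ => t ^ σ := by
  have h1 : (fun t => Complex.exp (w * rayLog Ψ t)) =O[atTop] fun t : ℝ => t ^ w.re := by
    refine IsBigO.of_bound ‖Complex.exp (w * (Ψ * Complex.I))‖ ?_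
    filter_upwards [eventually_gt_atTop 0] with t ht
    rw [norm_exp_mul_rayLog Ψ ht, Real.norm_of_nonneg (Real.rpow_nonneg ht.le _)]
  refine (h1.mul (isBigO_rayLog_pow Ψ k (sub_pos.2 hσ))).trans_eventuallyEq ?_
  filter_upwards [eventually_gt_atTop 0] with t ht
  rw [← Real.rpow_add ht, add_sub_cancel]

theorem integrableOn_Ioi_one_of_isBigO {f : ℝ → ℂ} (hf : ContinuousOn f (Set.Ioi 0)) {b : ℝ}
    (hb : b < -1) (ho : f =O[atTop] fun t => t ^ b) :
    MeasureTheory.IntegrableOn f (Set.Ioi 1) := by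
  have h1 : MeasureTheory.LocallyIntegrableOn f (Set.Ici 1) :=
    (hf.mono fun t (ht : 1 ≤ t) => lt_of_lt_of_le one_pos ht).locallyIntegrableOn measurableSet_Ici
  exact (h1.integrableOn_of_isBigO_atTop ho
    ⟨Set.Ioi 1, Ioi_mem_atTop 1, integrableOn_Ioi_rpow_of_lt hb one_pos⟩).mono_set
    Set.Ioi_subset_Ici_self

/-- The function `∫_1^∞ ℓ ^ k e^{-wℓ} dt / t` of `w`, where `ℓ = ln t + iΨ`. -/
noncomputable def logPole (Ψ : ℝ) : ℕ → ℂ → ℂ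
  | 0, w => Complex.exp (-w * (Ψ * Complex.I)) / w
  | k + 1, w => ((Ψ * Complex.I) ^ (k + 1) * Complex.exp (-w * (Ψ * Complex.I)) +
      (k + 1) * logPole Ψ k w) / w

theorem integrableOn_logPole (Ψ : ℝ) (k : ℕ) {w : ℂ} (hw : 0 < w.re) :
    MeasureTheory.IntegrableOn
      (fun t : ℝ => Complex.exp (-w * rayLog Ψ t) * rayLog Ψ t ^ k * (t : ℂ)⁻¹) (Set.Ioi 1) := by
  have hc := continuousOn_rayLog Ψ
  refine integrableOn_Ioi_one_of_isBigO (b := -(w.re / 2) - 1) ?_ (by linarith) ?_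
  · refine ((hc.const_mul _).cexp.mul (hc.pow k)).mul (ContinuousOn.inv₀ (by fun_prop) ?_)
    exact fun t ht => by exact_mod_cast (Set.mem_Ioi.1 ht).ne'
  · have h1 := isBigO_exp_mul_rayLog_mul_pow Ψ k (-w) (σ := -(w.re / 2)) (by simp; linarith)
    have h2 : (fun t : ℝ => (t : ℂ)⁻¹) =O[atTop] fun t : ℝ => t⁻¹ :=
      IsBigO.of_bound 1 (Eventually.of_forall fun t => by simp)
    refine (h1.mul h2).trans_eventuallyEq ?_
    filter_upwards [eventually_gt_atTop 0] with t ht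
    simp only [Real.rpow_sub_one ht.ne', div_eq_mul_inv]

/-- Integrating the derivative of `e^{-wℓ} ℓ^k` from `1`, where `ℓ = iΨ`, to infinity yields the
recursion that defines `logPole`. -/
theorem integral_logPole (Ψ : ℝ) (k : ℕ) {w : ℂ} (hw : 0 < w.re) :
    ∫ t in Set.Ioi (1 : ℝ), Complex.exp (-w * rayLog Ψ t) * rayLog Ψ t ^ k * (t : ℂ)⁻¹ =
      logPole Ψ k w := by
  have hw0 : w ≠ 0 := by rintro rfl; simp at hw
  have hlog1 : rayLog Ψ 1 = Ψ * Complex.I := by simp [rayLog]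
  have hlim : ∀ k : ℕ, Tendsto (fun t => Complex.exp (-w * rayLog Ψ t) * rayLog Ψ t ^ k) atTop
      (𝓝 0) := fun k =>
    (isBigO_exp_mul_rayLog_mul_pow Ψ k (-w) (σ := -(w.re / 2)) (by simp; linarith)).trans_tendsto
      (tendsto_rpow_neg_atTop (by linarith))
  have hder : ∀ k : ℕ, ∀ t ∈ Set.Ici (1 : ℝ), HasDerivAt
      (fun t => Complex.exp (-w * rayLog Ψ t) * rayLog Ψ t ^ k)
      (Complex.exp (-w * rayLog Ψ t) * (-w * (t : ℂ)⁻¹) * rayLog Ψ t ^ k +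
        Complex.exp (-w * rayLog Ψ t) * (k * rayLog Ψ t ^ (k - 1) * (t : ℂ)⁻¹)) t := by
    intro k t ht
    have h := hasDerivAt_rayLog Ψ (lt_of_lt_of_le one_pos ht)
    exact (h.const_mul (-w)).cexp.mul (h.pow k)
  induction k with
  | zero =>
    have h1 := MeasureTheory.integral_Ioi_of_hasDerivAt_of_tendsto'
      (f' := fun t => -w * (Complex.exp (-w * rayLog Ψ t) * rayLog Ψ t ^ 0 * (t : ℂ)⁻¹))
      (fun t ht => (hder 0 t ht).congr_deriv (by push_cast; ring))
      ((integrableOn_logPole Ψ 0 hw).const_mul _) (hlim 0)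
    rw [MeasureTheory.integral_const_mul, hlog1] at h1
    rw [logPole, eq_div_iff hw0]
    linear_combination -h1
  | succ k ih =>
    have h1 := MeasureTheory.integral_Ioi_of_hasDerivAt_of_tendsto'
      (f' := fun t => -w * (Complex.exp (-w * rayLog Ψ t) * rayLog Ψ t ^ (k + 1) * (t : ℂ)⁻¹) +
        (k + 1) * (Complex.exp (-w * rayLog Ψ t) * rayLog Ψ t ^ k * (t : ℂ)⁻¹))
      (fun t ht => (hder (k + 1) t ht).congr_deriv (by
        rw [Nat.add_sub_cancel]; push_cast; ring))
      (((integrableOn_logPole Ψ (k + 1) hw).const_mul _).add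
        ((integrableOn_logPole Ψ k hw).const_mul _)) (hlim (k + 1))
    rw [MeasureTheory.integral_add ((integrableOn_logPole Ψ (k + 1) hw).const_mul _)
      ((integrableOn_logPole Ψ k hw).const_mul _), MeasureTheory.integral_const_mul,
      MeasureTheory.integral_const_mul, ih, hlog1] at h1
    rw [logPole, eq_div_iff hw0]
    linear_combination -h1

/-- Formally, differentiating the integral in `w` brings down `-ℓ`. The proof uses the recursion
instead, and so reaches every `w ≠ 0`. -/
theorem hasDerivAt_logPole (Ψ : ℝ) (k : ℕ) {w : ℂ} (hw : w ≠ 0) :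
    HasDerivAt (logPole Ψ k) (-logPole Ψ (k + 1) w) w := by
  have hE : HasDerivAt (fun w : ℂ => Complex.exp (-w * (Ψ * Complex.I)))
      (Complex.exp (-w * (Ψ * Complex.I)) * (-1 * (Ψ * Complex.I))) w :=
    ((hasDerivAt_neg w).mul_const _).cexp
  induction k with
  | zero =>
    refine (hE.div (hasDerivAt_id w) hw).congr_deriv ?_
    simp only [logPole, id]
    push_cast
    field_simp
    ring
  | succ k ih =>
    have h := ((hE.const_mul ((Ψ * Complex.I) ^ (k + 1))).add
      (ih.const_mul ((k : ℂ) + 1))).div (hasDerivAt_id w) hw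
    refine h.congr_deriv ?_
    simp only [logPole, id, Pi.add_apply]
    push_cast
    field_simp
    ring

/-- The case `k = 0` is immediate and each further power of `ℓ` is one application of `-d/dw`, so
the principal part stays a single term, unaffected by the shift `iΨ` in the logarithm. -/
theorem exists_logPole_eq (Ψ : ℝ) (k : ℕ) : ∃ φ : ℂ → ℂ, Differentiable ℂ φ ∧
    ∀ w, w ≠ 0 → logPole Ψ k w = k.factorial / w ^ (k + 1) + φ w := by
  induction k with
  | zero =>
    refine ⟨dslope (fun w => Complex.exp (-w * (Ψ * Complex.I))) 0, ?_, fun w hw => ?_⟩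
    · rw [← differentiableOn_univ, Complex.differentiableOn_dslope univ_mem, differentiableOn_univ]
      fun_prop
    · rw [dslope_of_ne _ hw, slope_def_field, logPole]
      simp only [neg_zero, zero_mul, Complex.exp_zero, sub_zero]
      simp
      field_simp
      ring
  | succ k ih =>
    obtain ⟨φ, hφ, h⟩ := ih
    refine ⟨fun w => -deriv φ w, ?_, fun w hw => ?_⟩
    · rw [← differentiableOn_univ] at hφ ⊢
      exact (hφ.deriv isOpen_univ).neg
    · have h1 : HasDerivAt (fun w => (k.factorial : ℂ) / w ^ (k + 1) + φ w)
          (-logPole Ψ (k + 1) w) w := (hasDerivAt_logPole Ψ k hw).congr_of_eventuallyEq (by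
        filter_upwards [isOpen_ne.mem_nhds hw] with v hv using (h v hv).symm)
      have h2 := ((hasDerivAt_const w (k.factorial : ℂ)).div (hasDerivAt_pow (k + 1) w)
        (pow_ne_zero _ hw)).add (hφ w).hasDerivAt
      have h3 := h1.unique h2
      rw [neg_eq_iff_eq_neg] at h3
      rw [h3, Nat.factorial_succ, Nat.add_sub_cancel]
      push_cast
      field_simp
      ring

theorem meromorphicAt_logPole (Ψ : ℝ) (k : ℕ) (w : ℂ) : MeromorphicAt (logPole Ψ k) w := by
  obtain ⟨φ, hφ, h⟩ := exists_logPole_eq Ψ k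
  have h1 : MeromorphicAt (fun w => (k.factorial : ℂ) / w ^ (k + 1) + φ w) w :=
    ((MeromorphicAt.const _ w).div ((MeromorphicAt.id w).pow _)).add
      (hφ.analyticAt w).meromorphicAt
  refine h1.congr ?_
  rcases eq_or_ne w 0 with rfl | hw
  · filter_upwards [self_mem_nhdsWithin] with v hv using (h v hv).symm
  · filter_upwards [mem_nhdsWithin_of_mem_nhds (isOpen_ne.mem_nhds hw)] with v hv
      using (h v hv).symm

theorem analyticAt_logPole (Ψ : ℝ) (k : ℕ) {w : ℂ} (hw : w ≠ 0) :
    AnalyticAt ℂ (logPole Ψ k) w := by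
  have : DifferentiableOn ℂ (logPole Ψ k) {0}ᶜ := fun v hv =>
    (hasDerivAt_logPole Ψ k hv).differentiableAt.differentiableWithinAt
  exact this.analyticAt (isOpen_compl_singleton.mem_nhds hw)

/-! ### Splitting the Mellin integral at `1` and integration by parts. -/

theorem locallyIntegrableOn_indicator {f : ℝ → ℂ} (hf : ContinuousOn f (Set.Ioi 0)) {A : Set ℝ}
    (hA : MeasurableSet A) :
    MeasureTheory.LocallyIntegrableOn (A.indicator f) (Set.Ioi 0) := by
  rw [MeasureTheory.locallyIntegrableOn_iff isOpen_Ioi.isLocallyClosed]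
  intro K hK hKc
  exact ((hf.mono hK).integrableOn_compact hKc).indicator hA

theorem mellin_indicator_Iic_one {f : ℝ → ℂ} (hf : ContinuousOn f (Set.Ioi 0)) {b C : ℝ}
    (hb : ∀ t, 0 < t → ‖f t‖ ≤ C * t ^ b) {s : ℂ} (hs : -b < s.re) :
    MellinConvergent ((Set.Iic 1).indicator f) s ∧
      DifferentiableAt ℂ (mellin ((Set.Iic 1).indicator f)) s := by
  have h1 := locallyIntegrableOn_indicator hf (measurableSet_Iic (a := (1 : ℝ)))
  -- The cut-off function vanishes beyond `1`, so any rate of decay may be claimed; this one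
  -- suffices at `s`.
  have h2 : (Set.Iic 1).indicator f =O[atTop] fun t : ℝ => t ^ (-(s.re + 1)) := by
    refine IsBigO.of_bound 0 ?_
    filter_upwards [eventually_gt_atTop 1] with t ht
    rw [Set.indicator_of_notMem (by simpa using ht)]
    simp
  have h3 : (Set.Iic 1).indicator f =O[𝓝[>] 0] fun t : ℝ => t ^ (-(-b)) := by
    refine IsBigO.of_bound C ?_
    filter_upwards [self_mem_nhdsWithin] with t ht
    have ht : 0 < t := ht
    rw [neg_neg, Real.norm_of_nonneg (Real.rpow_nonneg ht.le _)]
    exact (norm_indicator_le_norm_self _ _).trans (hb t ht)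
  exact ⟨mellinConvergent_of_isBigO_rpow h1 h2 (by linarith) h3 hs,
    mellin_differentiableAt_of_isBigO_rpow h1 h2 (by linarith) h3 hs⟩

theorem mellin_indicator_Ioi_one {f : ℝ → ℂ} (hf : ContinuousOn f (Set.Ioi 0)) {b : ℝ}
    (hb : f =O[atTop] fun t => t ^ b) {s : ℂ} (hs : s.re < -b) :
    MellinConvergent ((Set.Ioi 1).indicator f) s ∧
      DifferentiableAt ℂ (mellin ((Set.Ioi 1).indicator f)) s := by
  have h1 := locallyIntegrableOn_indicator hf (measurableSet_Ioi (a := (1 : ℝ)))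
  have h2 : (Set.Ioi 1).indicator f =O[atTop] fun t : ℝ => t ^ (-(-b)) := by
    rw [neg_neg]
    exact (IsBigO.of_bound 1 (Eventually.of_forall fun t => by
      rw [one_mul]; exact norm_indicator_le_norm_self _ _)).trans hb
  have h3 : (Set.Ioi 1).indicator f =O[𝓝[>] 0] fun t : ℝ => t ^ (-(s.re - 1)) := by
    refine IsBigO.of_bound 0 ?_
    filter_upwards [mem_nhdsWithin_of_mem_nhds (Iio_mem_nhds (zero_lt_one (α := ℝ)))] with t ht
    rw [Set.indicator_of_notMem (by simpa using (Set.mem_Iio.1 ht).le)]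
    simp
  exact ⟨mellinConvergent_of_isBigO_rpow h1 h2 hs h3 (by linarith),
    mellin_differentiableAt_of_isBigO_rpow h1 h2 hs h3 (by linarith)⟩

theorem cpow_smul_indicator (f : ℝ → ℂ) (A : Set ℝ) (s : ℂ) :
    (fun t : ℝ => (t : ℂ) ^ (s - 1) • A.indicator f t) =
      A.indicator fun t : ℝ => (t : ℂ) ^ (s - 1) • f t := by
  ext t
  by_cases h : t ∈ A <;> simp [h]

theorem mellin_indicator_Ioi_one_eq (f : ℝ → ℂ) (s : ℂ) :
    mellin ((Set.Ioi 1).indicator f) s = ∫ t in Set.Ioi (1 : ℝ), (t : ℂ) ^ (s - 1) • f t := by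
  rw [mellin, cpow_smul_indicator, MeasureTheory.setIntegral_indicator measurableSet_Ioi,
    Set.Ioi_inter_Ioi, max_eq_right zero_le_one]

theorem MellinConvergent.integrableOn_Ioi_one {f : ℝ → ℂ} {s : ℂ}
    (h : MellinConvergent ((Set.Ioi 1).indicator f) s) :
    MeasureTheory.IntegrableOn (fun t : ℝ => (t : ℂ) ^ (s - 1) • f t) (Set.Ioi 1) := by
  rw [MellinConvergent, cpow_smul_indicator] at h
  have h2 := MeasureTheory.IntegrableOn.mono_set h (Set.Ioi_subset_Ioi zero_le_one)
  exact h2.congr_fun (fun t ht => Set.indicator_of_mem ht _) measurableSet_Ioi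

theorem mellin_eq_add_indicator (f : ℝ → ℂ) {s : ℂ}
    (h1 : MellinConvergent ((Set.Iic 1).indicator f) s)
    (h2 : MellinConvergent ((Set.Ioi 1).indicator f) s) :
    mellin f s = mellin ((Set.Iic 1).indicator f) s + mellin ((Set.Ioi 1).indicator f) s := by
  rw [← (hasMellin_add h1 h2).2]
  congr 1
  rw [← Set.compl_Iic]
  exact (Set.indicator_self_add_compl _ f).symm

theorem cpow_mul_exp_mul_rayLog (Ψ : ℝ) (k : ℕ) (s β : ℂ) {t : ℝ} (ht : 0 < t) :
    (t : ℂ) ^ (-s) * (Complex.exp (β * rayLog Ψ t) * rayLog Ψ t ^ k) =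
      Complex.exp (s * (Ψ * Complex.I)) *
        (Complex.exp (-(s - β) * rayLog Ψ t) * rayLog Ψ t ^ k) := by
  have h1 : Complex.exp (-(s - β) * rayLog Ψ t) =
      Complex.exp (-s * rayLog Ψ t) * Complex.exp (β * rayLog Ψ t) := by
    rw [← Complex.exp_add]; congr 1; ring
  have h2 : Complex.exp (s * (Ψ * Complex.I)) * Complex.exp (-s * (Ψ * Complex.I)) = 1 := by
    rw [← Complex.exp_add]; simp
  rw [h1, exp_mul_rayLog Ψ ht (-s)]
  linear_combination -((t : ℂ) ^ (-s) * Complex.exp (β * rayLog Ψ t) * rayLog Ψ t ^ k) * h2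

/-- Integration by parts for a function with an expansion into powers and logarithms. -/
theorem integral_Ioi_one_cpow_mul_deriv {h h' r : ℝ → ℂ} {ι : Type*} (Ψ : ℝ) (S : Finset ι)
    (c β : ι → ℂ) (k : ι → ℕ) {ν : ℝ} {s : ℂ} (hh : ∀ t, 0 < t → HasDerivAt h (h' t) t)
    (hdec : ∀ t, 0 < t →
      h t = r t + ∑ x ∈ S, c x * (Complex.exp (β x * rayLog Ψ t) * rayLog Ψ t ^ k x))
    (hr : ContinuousOn r (Set.Ioi 0)) (hO : r =O[atTop] fun t => t ^ ν) (hν : ν < s.re)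
    (hβ : ∀ x ∈ S, (β x).re < s.re)
    (hint : MeasureTheory.IntegrableOn (fun t : ℝ => (t : ℂ) ^ (-s) * h' t) (Set.Ioi 1)) :
    ∫ t in Set.Ioi (1 : ℝ), (t : ℂ) ^ (-s) * h' t =
      -h 1 + s * (mellin ((Set.Ioi 1).indicator r) (-s) + Complex.exp (s * (Ψ * Complex.I)) *
        ∑ x ∈ S, c x * logPole Ψ (k x) (s - β x)) := by
  have hre : ∀ x ∈ S, 0 < (s - β x).re := fun x hx => by
    rw [Complex.sub_re]; linarith [hβ x hx]
  have hmel := (mellin_indicator_Ioi_one hr hO (s := -s) (by simpa using hν)).1.integrableOn_Ioi_one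
  have hpole := fun x (hx : x ∈ S) => (integrableOn_logPole Ψ (k x) (hre x hx)).const_mul (c x)
  have hpole' := (MeasureTheory.integrable_finsetSum S hpole).const_mul
    (Complex.exp (s * (Ψ * Complex.I)))
  have hdec2 : ∀ t ∈ Set.Ioi (1 : ℝ), (t : ℂ) ^ (-s - 1) * h t = (t : ℂ) ^ (-s - 1) • r t +
      Complex.exp (s * (Ψ * Complex.I)) * ∑ x ∈ S, c x *
        (Complex.exp (-(s - β x) * rayLog Ψ t) * rayLog Ψ t ^ k x * (t : ℂ)⁻¹) := by
    intro t ht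
    have ht : 0 < t := lt_trans one_pos ht
    rw [hdec t ht, mul_add, smul_eq_mul, Finset.mul_sum, Finset.mul_sum]
    congr 1
    refine Finset.sum_congr rfl fun x _ => ?_
    rw [Complex.cpow_sub _ _ (by exact_mod_cast ht.ne'), Complex.cpow_one]
    have := cpow_mul_exp_mul_rayLog Ψ (k x) s (β x) ht
    linear_combination (c x * (t : ℂ)⁻¹) * this
  have hI : MeasureTheory.IntegrableOn (fun t : ℝ => (t : ℂ) ^ (-s - 1) * h t) (Set.Ioi 1) :=
    MeasureTheory.IntegrableOn.congr_fun (hmel.add hpole') (fun t ht => (hdec2 t ht).symm)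
      measurableSet_Ioi
  have hval : ∫ t in Set.Ioi (1 : ℝ), (t : ℂ) ^ (-s - 1) * h t =
      mellin ((Set.Ioi 1).indicator r) (-s) + Complex.exp (s * (Ψ * Complex.I)) *
        ∑ x ∈ S, c x * logPole Ψ (k x) (s - β x) := by
    rw [MeasureTheory.setIntegral_congr_fun measurableSet_Ioi hdec2,
      MeasureTheory.integral_add hmel hpole', MeasureTheory.integral_const_mul,
      MeasureTheory.integral_finsetSum S hpole, mellin_indicator_Ioi_one_eq]
    congr 2
    refine Finset.sum_congr rfl fun x hx => ?_
    rw [MeasureTheory.integral_const_mul, integral_logPole Ψ (k x) (hre x hx)]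
  -- No boundary term at infinity, since `ν` and all `Re (β x)` are below `Re s`; the one at `1` is
  -- `-h 1`.
  have hlim : Tendsto (fun t : ℝ => (t : ℂ) ^ (-s) * h t) atTop (𝓝 0) := by
    have l1 : Tendsto (fun t : ℝ => (t : ℂ) ^ (-s) * r t) atTop (𝓝 0) := by
      have e1 : (fun t : ℝ => (t : ℂ) ^ (-s)) =O[atTop] fun t : ℝ => t ^ (-s.re) := by
        refine IsBigO.of_bound 1 ?_
        filter_upwards [eventually_gt_atTop 0] with t ht
        rw [Complex.norm_cpow_eq_rpow_re_of_pos ht, one_mul, Complex.neg_re]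
        exact le_abs_self _
      have e2 := (e1.mul hO).trans_eventuallyEq (g₂ := fun t : ℝ => t ^ (-(s.re - ν))) (by
        filter_upwards [eventually_gt_atTop 0] with t ht
        rw [← Real.rpow_add ht]; congr 1; ring)
      exact e2.trans_tendsto (tendsto_rpow_neg_atTop (by linarith))
    have l2 : Tendsto (fun t : ℝ => Complex.exp (s * (Ψ * Complex.I)) * ∑ x ∈ S, c x *
        (Complex.exp (-(s - β x) * rayLog Ψ t) * rayLog Ψ t ^ k x)) atTop (𝓝 0) := by
      have : ∀ x ∈ S, Tendsto (fun t : ℝ => c x *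
          (Complex.exp (-(s - β x) * rayLog Ψ t) * rayLog Ψ t ^ k x)) atTop (𝓝 0) := by
        intro x hx
        have h0 := hre x hx
        have := ((isBigO_exp_mul_rayLog_mul_pow Ψ (k x) (-(s - β x))
          (σ := -((s - β x).re / 2)) (by rw [Complex.neg_re]; linarith)).trans_tendsto
          (tendsto_rpow_neg_atTop (by linarith))).const_mul (c x)
        simpa using this
      have := (tendsto_finsetSum S this).const_mul (Complex.exp (s * (Ψ * Complex.I)))
      simpa using this
    have l3 := l1.add l2
    rw [add_zero] at l3
    refine l3.congr' ?_
    filter_upwards [eventually_gt_atTop 0] with t ht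
    rw [hdec t ht, mul_add, Finset.mul_sum, Finset.mul_sum]
    congr 1
    refine Finset.sum_congr rfl fun x _ => ?_
    linear_combination -(c x) * cpow_mul_exp_mul_rayLog Ψ (k x) s (β x) ht
  have hder : ∀ t ∈ Set.Ici (1 : ℝ), HasDerivAt (fun t : ℝ => (t : ℂ) ^ (-s) * h t)
      (-s * ((t : ℂ) ^ (-s - 1) * h t) + (t : ℂ) ^ (-s) * h' t) t := by
    intro t ht
    have ht : 0 < t := lt_of_lt_of_le one_pos ht
    have e1 : HasDerivAt (fun t : ℝ => (t : ℂ) ^ (-s)) (-s * (t : ℂ) ^ (-s - 1)) t := by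
      have := ((hasDerivAt_id (t : ℂ)).cpow_const (c := -s) (Or.inl (by simpa using ht))).comp_ofReal
      simpa using this
    refine (e1.mul (hh t ht)).congr_deriv ?_
    ring
  have key := MeasureTheory.integral_Ioi_of_hasDerivAt_of_tendsto' hder
    ((hI.const_mul (-s)).add hint) hlim
  rw [MeasureTheory.integral_add (hI.const_mul (-s)) hint, MeasureTheory.integral_const_mul,
    hval, Complex.ofReal_one, Complex.one_cpow, one_mul] at key
  linear_combination key

/-! ### The continuation formula. -/

/-- `ln F` minus its Taylor polynomial of degree `p`, along the ray of argument `Ψ`. -/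
noncomputable def rayPrim (F L : ℂ → ℂ) (Ψ : ℝ) (p : ℕ) (t : ℝ) : ℂ :=
  L (t * Complex.exp (Ψ * Complex.I)) - ∑ i ∈ Finset.range p,
    logCoeff (taylorCoeff F) (i + 1) * (t * Complex.exp (Ψ * Complex.I)) ^ (i + 1)

/-- The remainder of the expansion of `ln F` along the ray of argument `Ψ`. -/
noncomputable def rayRem (L : ℂ → ℂ) (Ψ α : ℝ) (m : ℕ) (d : ℕ → ℕ → ℂ) (N M : ℕ) (t : ℝ) : ℂ :=
  L (t * Complex.exp (Ψ * Complex.I)) -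
    ∑ j ∈ Finset.range (N + 1), ∑ k ∈ Finset.range (M + 1),
      d j k * Complex.exp (((α - (j : ℝ) / (m : ℝ) : ℝ) : ℂ) * rayLog Ψ t) * rayLog Ψ t ^ k

/-- The indices of the terms in the expansion of `rayPrim`: those of the expansion of `ln F` and
those of the Taylor polynomial. -/
def termIndex (N M p : ℕ) : Finset ((ℕ × ℕ) ⊕ ℕ) :=
  (Finset.range (N + 1) ×ˢ Finset.range (M + 1)).disjSum (Finset.range p)

/-- The coefficients in the expansion of `rayPrim`. -/
noncomputable def termCoeff (F : ℂ → ℂ) (d : ℕ → ℕ → ℂ) : (ℕ × ℕ) ⊕ ℕ → ℂ :=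
  Sum.elim (fun x => d x.1 x.2) fun i => -logCoeff (taylorCoeff F) (i + 1)

/-- The exponents in the expansion of `rayPrim`. -/
noncomputable def termExponent (α : ℝ) (m : ℕ) : (ℕ × ℕ) ⊕ ℕ → ℂ :=
  Sum.elim (fun x => ((α - (x.1 : ℝ) / (m : ℝ) : ℝ) : ℂ)) fun i => (i : ℂ) + 1

/-- The powers of the logarithm in the expansion of `rayPrim`. -/
def termPower : (ℕ × ℕ) ⊕ ℕ → ℕ := Sum.elim Prod.snd fun _ => 0

/-- The continuation of the zeta function given by an expansion of `ln F`. -/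
noncomputable def zetaCont (F L : ℂ → ℂ) (Ψ α : ℝ) (m : ℕ) (d : ℕ → ℕ → ℂ) (N M p : ℕ) (s : ℂ) :
    ℂ :=
  Complex.exp (s * (Real.pi * Complex.I)) * (Complex.sin (Real.pi * s) / Real.pi) *
    (Complex.exp (-s * (Ψ * Complex.I)) *
        (mellin ((Set.Iic 1).indicator (rayTail F Ψ p)) (1 - s) - rayPrim F L Ψ p 1 +
          s * mellin ((Set.Ioi 1).indicator (rayRem L Ψ α m d N M)) (-s)) +
      s * ∑ x ∈ termIndex N M p, termCoeff F d x *
        logPole Ψ (termPower x) (s - termExponent α m x))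

section

variable {a : ℕ → ℂ} {Ψ ε α : ℝ} {F L : ℂ → ℂ} {m : ℕ} {d : ℕ → ℕ → ℂ} {N M : ℕ} {δ : ℝ} {p : ℕ}

/-- The derivative of `L` is `F'/F`, and `(i + 1) b_{i+1}` is the Taylor coefficient of index `i` of
`F'/F`, so differentiating the subtracted polynomial leaves exactly the tail. -/
theorem hasDerivAt_rayPrim (hS : IsZetaSequence a Ψ ε α) (hF : IsCharacteristicFunction a α F)
    (hL : IsLogBranchOn F L (sector Ψ ε)) (p : ℕ) {t : ℝ} (ht : 0 < t) :
    HasDerivAt (rayPrim F L Ψ p) (rayTail F Ψ p t) t := by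
  set e := Complex.exp (Ψ * Complex.I) with he
  have hnhds : sector Ψ ε ∈ 𝓝 (t * e) := sector_mem_nhds_ray hS.eps_pos ht
  have hFz : F (t * e) ≠ 0 := hF.ne_zero_of_mem_sector hS (ray_mem_sector hS.eps_pos ht)
  have hLd : HasDerivAt L (logDeriv F (t * e)) (t * e) := by
    have h1 := (hL.1.differentiableAt hnhds).hasDerivAt
    have h2 : HasDerivAt F (Complex.exp (L (t * e)) * deriv L (t * e)) (t * e) :=
      h1.cexp.congr_of_eventuallyEq (by
        filter_upwards [hnhds] with z hz using (hL.2 z hz).symm)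
    have h3 : deriv L (t * e) = logDeriv F (t * e) := by
      rw [logDeriv_apply, h2.deriv, hL.2 _ (mem_of_mem_nhds hnhds), mul_div_cancel_left₀ _ hFz]
    rwa [h3] at h1
  have hpoly : HasDerivAt (fun z => ∑ i ∈ Finset.range p,
      logCoeff (taylorCoeff F) (i + 1) * z ^ (i + 1))
      (∑ i ∈ Finset.range p, taylorTail i (logDeriv F) 0 * (t * e) ^ i) (t * e) := by
    refine HasDerivAt.fun_sum fun i _ => ?_
    refine ((hasDerivAt_pow (i + 1) (t * e)).const_mul _).congr_deriv ?_
    have han : AnalyticAt ℂ (logDeriv F) 0 :=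
      (hF.entire.analyticAt 0).deriv.div (hF.entire.analyticAt 0) (hF.apply_zero_ne_zero hS)
    rw [taylorTail_apply_zero han, taylorCoeff_logDeriv hF.entire (hF.apply_zero_ne_zero hS),
      Nat.add_sub_cancel]
    push_cast
    ring
  have hray : HasDerivAt (fun t : ℝ => (t : ℂ) * e) e t := by
    simpa using (Complex.ofRealCLM.hasDerivAt (x := t)).mul_const e
  have h := (hLd.sub hpoly).comp_of_eq t hray rfl
  refine h.congr_deriv ?_
  rw [eq_sum_add_pow_mul_taylorTail (logDeriv F) p (t * e), rayTail, ← he]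
  ring

theorem continuousOn_rayRem (hS : IsZetaSequence a Ψ ε α)
    (hL : IsLogBranchOn F L (sector Ψ ε)) :
    ContinuousOn (rayRem L Ψ α m d N M) (Set.Ioi 0) := by
  have h1 := continuousOn_rayLog Ψ
  have h2 : ContinuousOn (fun t : ℝ => L (t * Complex.exp (Ψ * Complex.I))) (Set.Ioi 0) := by
    intro t ht
    have h3 := (hL.1.differentiableAt (sector_mem_nhds_ray hS.eps_pos ht)).continuousAt
    refine (ContinuousAt.comp' (f := fun t : ℝ => (t : ℂ) * Complex.exp (Ψ * Complex.I)) h3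
      (by fun_prop)).continuousWithinAt
  refine h2.sub (continuousOn_finsetSum _ fun j _ => continuousOn_finsetSum _ fun k _ => ?_)
  exact (continuousOn_const.mul (continuousOn_const.mul h1).cexp).mul (h1.pow k)

theorem isBigO_rayRem (hε : 0 < ε) (hE : HasLogExpansion L Ψ ε α m d N M δ) :
    rayRem L Ψ α m d N M =O[atTop] fun t => t ^ (α - (N : ℝ) / (m : ℝ) - δ) := by
  have hnorm : ∀ t : ℝ, 0 < t → ‖(t : ℂ) * Complex.exp (Ψ * Complex.I)‖ = t := fun t ht => by
    rw [norm_mul, Complex.norm_exp_ofReal_mul_I, Complex.norm_real, mul_one,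
      Real.norm_of_nonneg ht.le]
  have hlim : Tendsto (fun t : ℝ => (t : ℂ) * Complex.exp (Ψ * Complex.I)) atTop
      (cobounded ℂ ⊓ 𝓟 (sector Ψ ε)) := by
    refine tendsto_inf.2 ⟨?_, tendsto_principal.2 ?_⟩
    · rw [← tendsto_norm_atTop_iff_cobounded]
      refine tendsto_id.congr' ?_
      filter_upwards [eventually_gt_atTop 0] with t ht using (hnorm t ht).symm
    · filter_upwards [eventually_gt_atTop 0] with t ht using ray_mem_sector hε ht
  have h := (IsLittleO.comp_tendsto hE hlim).isBigO
  refine (h.congr' ?_ ?_)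
  · filter_upwards [eventually_gt_atTop 0] with t ht
    simp only [Function.comp_apply, logAround_ray Ψ ht, rayRem]
  · filter_upwards [eventually_gt_atTop 0] with t ht
    simp only [Function.comp_apply, hnorm t ht]

theorem rayPrim_eq_rayRem_add_sum (F L : ℂ → ℂ) (Ψ α : ℝ) (m : ℕ) (d : ℕ → ℕ → ℂ) (N M p : ℕ)
    {t : ℝ} (ht : 0 < t) :
    rayPrim F L Ψ p t = rayRem L Ψ α m d N M t + ∑ x ∈ termIndex N M p, termCoeff F d x *
      (Complex.exp (termExponent α m x * rayLog Ψ t) * rayLog Ψ t ^ termPower x) := by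
  rw [termIndex, Finset.sum_disjSum, Finset.sum_product, rayPrim, rayRem]
  have h1 : ∀ i : ℕ, Complex.exp (((i : ℂ) + 1) * rayLog Ψ t) =
      (t * Complex.exp (Ψ * Complex.I)) ^ (i + 1) := by
    intro i
    rw [exp_mul_rayLog Ψ ht, mul_pow, ← Complex.exp_nat_mul, mul_comm, ← Complex.cpow_natCast]
    push_cast
    rfl
  simp only [termCoeff, termExponent, termPower, Sum.elim_inl, Sum.elim_inr, pow_zero, mul_one,
    neg_mul, Finset.sum_neg_distrib, h1, mul_assoc]
  ring

theorem re_termExponent_le {x : (ℕ × ℕ) ⊕ ℕ} (hx : x ∈ termIndex N M p) (hp : (p : ℝ) ≤ α) :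
    (termExponent α m x).re ≤ α := by
  rcases x with x | i
  · simp only [termExponent, Sum.elim_inl, Complex.ofReal_re]
    have : 0 ≤ (x.1 : ℝ) / (m : ℝ) := by positivity
    linarith
  · have hi : i < p := by simpa [termIndex] using hx
    have : ((i : ℝ) + 1) ≤ p := by exact_mod_cast hi
    simp [termExponent]
    linarith

/-- `mellin_rayTail` is solved for the series after splitting the integral at `1` and integrating by
parts on `(1, ∞)`. The bound `p ≤ α` keeps the exponents of the Taylor polynomial to the left of
`s`. -/
theorem tsum_cutPow_eq_zetaCont (hS : IsZetaSequence a Ψ ε α)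
    (hF : IsCharacteristicFunction a α F) (hL : IsLogBranchOn F L (sector Ψ ε)) (hδ : 0 < δ)
    (hE : HasLogExpansion L Ψ ε α m d N M δ) (hp : (p : ℝ) ≤ α) {s : ℂ} (hs : α < s.re)
    (hs' : s.re < p + 1) :
    ∑' n, cutPow Ψ (a n) (-s) = zetaCont F L Ψ α m d N M p s := by
  obtain ⟨σ, hσ1, hσ2⟩ := exists_between hs
  obtain ⟨C₁, hC₁⟩ := exists_norm_rayTail_le hS hF (p := p) (σ := p + 1) (by linarith)
    (by linarith) le_rfl
  obtain ⟨C₂, hC₂⟩ := exists_norm_rayTail_le hS hF (p := p) (σ := σ) hσ1 (by linarith)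
    (by linarith)
  have hcont := continuousOn_rayTail hS hF p
  have hO : rayTail F Ψ p =O[atTop] fun t => t ^ (σ - 1) := by
    refine IsBigO.of_bound C₂ ?_
    filter_upwards [eventually_gt_atTop 0] with t ht
    rw [Real.norm_of_nonneg (Real.rpow_nonneg ht.le _)]
    exact hC₂ t ht
  have hm1 := (mellin_indicator_Iic_one hcont hC₁ (s := 1 - s) (by simp; linarith)).1
  have hm2 := (mellin_indicator_Ioi_one hcont hO (s := 1 - s) (by simp; linarith)).1
  have hint := hm2.integrableOn_Ioi_one
  have hν : α - (N : ℝ) / (m : ℝ) - δ < s.re := by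
    have : 0 ≤ (N : ℝ) / (m : ℝ) := by positivity
    linarith
  simp only [show 1 - s - 1 = -s by ring, smul_eq_mul] at hint
  have key := integral_Ioi_one_cpow_mul_deriv Ψ (termIndex N M p) (termCoeff F d)
    (termExponent α m) termPower (fun t ht => hasDerivAt_rayPrim hS hF hL p ht)
    (fun t ht => rayPrim_eq_rayRem_add_sum F L Ψ α m d N M p ht) (continuousOn_rayRem hS hL)
    (isBigO_rayRem hS.eps_pos hE) hν (fun x hx => (re_termExponent_le hx hp).trans_lt hs) hint
  have hsplit := mellin_eq_add_indicator (rayTail F Ψ p) hm1 hm2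
  rw [mellin_rayTail hS hF hs (hp.trans_lt hs) hs', mellin_indicator_Ioi_one_eq] at hsplit
  simp only [show 1 - s - 1 = -s by ring, smul_eq_mul] at hsplit
  rw [key] at hsplit
  -- The strip lies strictly between the consecutive integers `p` and `p + 1`.
  have hsin : Complex.sin (Real.pi * s) ≠ 0 := by
    rw [Complex.sin_ne_zero_iff]
    intro k hk
    have hsk : s = k := by
      have : (Real.pi : ℂ) ≠ 0 := by exact_mod_cast Real.pi_ne_zero
      rw [mul_comm] at hk
      exact mul_right_cancel₀ this hk
    rw [hsk, Complex.intCast_re] at hs hs'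
    have h1 : (p : ℤ) < k := by exact_mod_cast hp.trans_lt hs
    have h2 : k < (p : ℤ) + 1 := by exact_mod_cast hs'
    omega
  have hpi : (Real.pi : ℂ) ≠ 0 := by exact_mod_cast Real.pi_ne_zero
  have hE1 : Complex.exp (s * ((Ψ - Real.pi : ℝ) * Complex.I)) * Complex.exp (-s * (Ψ * Complex.I))
      * Complex.exp (s * (Real.pi * Complex.I)) = 1 := by
    rw [← Complex.exp_add, ← Complex.exp_add, ← Complex.exp_zero]
    congr 1
    push_cast
    ring
  have hE2 : Complex.exp (-s * (Ψ * Complex.I)) * Complex.exp (s * (Ψ * Complex.I)) = 1 := by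
    rw [← Complex.exp_add, ← Complex.exp_zero]
    congr 1
    ring
  set T := ∑' n, cutPow Ψ (a n) (-s)
  set P := ∑ x ∈ termIndex N M p, termCoeff F d x * logPole Ψ (termPower x) (s - termExponent α m x)
  have hT : T = Complex.exp (-s * (Ψ * Complex.I)) * Complex.exp (s * (Real.pi * Complex.I)) *
      (Complex.sin (Real.pi * s) / Real.pi) *
      (Complex.exp (s * ((Ψ - Real.pi : ℝ) * Complex.I)) *
        (Real.pi / Complex.sin (Real.pi * s)) * T) := by
    have : (Complex.sin (Real.pi * s) / Real.pi) * (Real.pi / Complex.sin (Real.pi * s)) = 1 := by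
      field_simp
    linear_combination (-T * (Complex.sin (Real.pi * s) / Real.pi) *
      (Real.pi / Complex.sin (Real.pi * s))) * hE1 - T * this
  rw [hT, hsplit, zetaCont]
  linear_combination (Complex.exp (s * (Real.pi * Complex.I)) *
    (Complex.sin (Real.pi * s) / Real.pi) * s * P) * hE2

end

/-! ### Values at the integers. -/

/-- A polynomial in `(z - z₀)⁻¹` of positive degree blows up at `z₀`; one with a finite limit is its
constant term. -/
theorem eq_sum_of_tendsto_sum_inv_pow {ι : Type*} (J : Finset ι) (c : ι → ℂ) (k : ι → ℕ) {z₀ l : ℂ}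
    (h : Tendsto (fun z => ∑ x ∈ J, c x * ((z - z₀)⁻¹) ^ k x) (𝓝[≠] z₀) (𝓝 l)) :
    l = ∑ x ∈ J with k x = 0, c x := by
  set P : Polynomial ℂ := ∑ x ∈ J, Polynomial.C (c x) * Polynomial.X ^ k x with hP
  have hev : ∀ z, P.eval ((z - z₀)⁻¹) = ∑ x ∈ J, c x * ((z - z₀)⁻¹) ^ k x := fun z => by
    simp [hP, Polynomial.eval_finsetSum]
  simp only [← hev] at h
  have hdeg : P.degree ≤ 0 := by
    by_contra! hdeg
    have hinv : Tendsto (fun z : ℂ => ‖(z - z₀)⁻¹‖) (𝓝[≠] z₀) atTop := by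
      have h1 : Tendsto (fun z : ℂ => z - z₀) (𝓝[≠] z₀) (𝓝[≠] 0) := by
        refine tendsto_nhdsWithin_iff.2 ⟨?_, ?_⟩
        · have : ContinuousAt (fun z : ℂ => z - z₀) z₀ := by fun_prop
          simpa [ContinuousAt] using this.tendsto.mono_left nhdsWithin_le_nhds
        · filter_upwards [self_mem_nhdsWithin] with z hz using sub_ne_zero.2 hz
      exact tendsto_norm_cobounded_atTop.comp (tendsto_inv₀_nhdsNE_zero.comp h1)
    exact not_tendsto_nhds_of_tendsto_atTop (P.tendsto_norm_atTop hdeg hinv) _ h.norm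
  rw [Polynomial.eq_C_of_degree_le_zero hdeg] at h
  simp only [Polynomial.eval_C] at h
  rw [← tendsto_nhds_unique tendsto_const_nhds h, hP, Polynomial.finsetSum_coeff,
    Finset.sum_filter]
  refine Finset.sum_congr rfl fun x _ => ?_
  rw [Polynomial.coeff_C_mul, Polynomial.coeff_X_pow]
  simp [eq_comm]

/-- The derivative at `n` is `e^{iπn} cos πn = cos² πn = 1`: the phase cancels the sign of the
sine's slope. -/
theorem tendsto_exp_mul_sin_div (n : ℤ) :
    Tendsto (fun s : ℂ => Complex.exp (s * (Real.pi * Complex.I)) *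
      (Complex.sin (Real.pi * s) / Real.pi) / (s - n)) (𝓝[≠] (n : ℂ)) (𝓝 1) := by
  have hpi : (Real.pi : ℂ) ≠ 0 := by exact_mod_cast Real.pi_ne_zero
  have hsin : Complex.sin (Real.pi * (n : ℂ)) = 0 := by
    rw [mul_comm]; exact Complex.sin_int_mul_pi n
  have hd : HasDerivAt (fun s : ℂ => Complex.exp (s * (Real.pi * Complex.I)) *
      (Complex.sin (Real.pi * s) / Real.pi)) 1 n := by
    have h1 : HasDerivAt (fun s : ℂ => Complex.exp (s * (Real.pi * Complex.I)))
        (Complex.exp (n * (Real.pi * Complex.I)) * (1 * (Real.pi * Complex.I))) n :=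
      ((hasDerivAt_id (n : ℂ)).mul_const _).cexp
    have h2 : HasDerivAt (fun s : ℂ => Complex.sin (Real.pi * s) / Real.pi)
        (Complex.cos (Real.pi * n) * (Real.pi * 1) / Real.pi) n :=
      (((hasDerivAt_id (n : ℂ)).const_mul _).csin).div_const _
    refine (h1.mul h2).congr_deriv ?_
    have h3 : Complex.exp (n * (Real.pi * Complex.I)) = Complex.cos (Real.pi * n) := by
      rw [← mul_assoc, Complex.exp_mul_I, mul_comm (n : ℂ), hsin, zero_mul, add_zero]
    have h4 := Complex.sin_sq_add_cos_sq (Real.pi * (n : ℂ))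
    rw [hsin] at h4 ⊢
    rw [h3]
    field_simp
    linear_combination h4
  refine hd.tendsto_slope.congr fun s => ?_
  rw [slope_def_field, hsin, zero_div, mul_zero, sub_zero]

section

variable {a : ℕ → ℂ} {Ψ ε α : ℝ} {F L : ℂ → ℂ} {m : ℕ} {d : ℕ → ℕ → ℂ} {N M : ℕ} {δ : ℝ} {p : ℕ}

theorem analyticAt_mellin_rayTail (hS : IsZetaSequence a Ψ ε α)
    (hF : IsCharacteristicFunction a α F) (hp : α < p + 1) {s : ℂ} (hs : s.re < p + 1) :
    AnalyticAt ℂ (fun s => mellin ((Set.Iic 1).indicator (rayTail F Ψ p)) (1 - s)) s := by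
  obtain ⟨C, hC⟩ := exists_norm_rayTail_le hS hF (p := p) (σ := p + 1) hp (by linarith) le_rfl
  have : DifferentiableOn ℂ
      (fun s => mellin ((Set.Iic 1).indicator (rayTail F Ψ p)) (1 - s)) {s | s.re < p + 1} := by
    intro w (hw : w.re < p + 1)
    have h := (mellin_indicator_Iic_one (continuousOn_rayTail hS hF p) hC (s := 1 - w)
      (by simp; linarith)).2
    exact (DifferentiableAt.comp w h (differentiableAt_id.const_sub 1)).differentiableWithinAt
  exact this.analyticAt ((isOpen_lt Complex.continuous_re continuous_const).mem_nhds hs)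

theorem analyticAt_mellin_rayRem (hS : IsZetaSequence a Ψ ε α)
    (hL : IsLogBranchOn F L (sector Ψ ε)) (hE : HasLogExpansion L Ψ ε α m d N M δ) {s : ℂ}
    (hs : α - (N : ℝ) / (m : ℝ) - δ < s.re) :
    AnalyticAt ℂ (fun s => mellin ((Set.Ioi 1).indicator (rayRem L Ψ α m d N M)) (-s)) s := by
  have : DifferentiableOn ℂ
      (fun s => mellin ((Set.Ioi 1).indicator (rayRem L Ψ α m d N M)) (-s))
      {s | α - (N : ℝ) / (m : ℝ) - δ < s.re} := by
    intro w (hw : α - (N : ℝ) / (m : ℝ) - δ < w.re)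
    have h := (mellin_indicator_Ioi_one (continuousOn_rayRem hS hL) (isBigO_rayRem hS.eps_pos hE)
      (s := -w) (by rw [Complex.neg_re]; linarith)).2
    exact (DifferentiableAt.comp w h differentiableAt_id.neg).differentiableWithinAt
  exact this.analyticAt ((isOpen_lt continuous_const Complex.continuous_re).mem_nhds hs)

theorem meromorphicAt_zetaCont (hS : IsZetaSequence a Ψ ε α)
    (hF : IsCharacteristicFunction a α F) (hL : IsLogBranchOn F L (sector Ψ ε))
    (hE : HasLogExpansion L Ψ ε α m d N M δ) (hp : α < p + 1) {s : ℂ} (hs : s.re < p + 1)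
    (hs' : α - (N : ℝ) / (m : ℝ) - δ < s.re) :
    MeromorphicAt (zetaCont F L Ψ α m d N M p) s := by
  have h1 := analyticAt_mellin_rayTail hS hF hp hs
  have h2 := analyticAt_mellin_rayRem hS hL hE hs'
  have h3 : ∀ c : ℂ, AnalyticAt ℂ (fun s => Complex.exp (s * c)) s := fun c => by fun_prop
  have h4 : AnalyticAt ℂ (fun s : ℂ => Complex.exp (-s * (Ψ * Complex.I))) s := by fun_prop
  have h5 : AnalyticAt ℂ (fun s : ℂ => Complex.sin (Real.pi * s) / Real.pi) s := by fun_prop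
  refine ((h3 _).mul h5).meromorphicAt.mul
    ((h4.mul ((h1.sub analyticAt_const).add (analyticAt_id.mul h2))).meromorphicAt.add
      (analyticAt_id.meromorphicAt.mul (MeromorphicAt.fun_sum fun x _ =>
        (MeromorphicAt.const _ s).mul ?_)))
  exact (meromorphicAt_logPole Ψ (termPower x) (s - termExponent α m x)).comp_analyticAt
    (f := logPole Ψ (termPower x)) (g := fun s => s - termExponent α m x) (by fun_prop)

/-- The terms with exponent `n` sum to `Q(s) / (s - n)` plus a continuous function, `Q` being a
polynomial in `(s - n)⁻¹`. As the prefactor is `W(s) (s - n)` with `W → 1`, regularity of `Z` forces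
`Q → Z n / n`, so `Q` is constant. -/
theorem apply_intCast_eq_of_eventuallyEq_zetaCont (hS : IsZetaSequence a Ψ ε α)
    (hF : IsCharacteristicFunction a α F) (hL : IsLogBranchOn F L (sector Ψ ε))
    (hE : HasLogExpansion L Ψ ε α m d N M δ) (hp : α < p + 1) {n : ℤ} (hn0 : n ≠ 0)
    (hnα : (n : ℝ) ≤ α) (hn : α - (N : ℝ) / (m : ℝ) - δ < n) {Z : ℂ → ℂ}
    (hZ : ContinuousAt Z n) (hZeq : Z =ᶠ[𝓝[≠] (n : ℂ)] zetaCont F L Ψ α m d N M p) :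
    Z n = n * ∑ x ∈ termIndex N M p with termExponent α m x = n ∧ termPower x = 0,
      termCoeff F d x := by
  have hn0' : (n : ℂ) ≠ 0 := by exact_mod_cast hn0
  choose φ hφ hφ' using exists_logPole_eq Ψ
  set J := (termIndex N M p).filter fun x => termExponent α m x = n with hJ
  set c' : (ℕ × ℕ) ⊕ ℕ → ℂ := fun x => termCoeff F d x * ((termPower x).factorial : ℂ) with hc'
  set Q : ℂ → ℂ := fun s => ∑ x ∈ J, c' x * ((s - n)⁻¹) ^ termPower x with hQ
  set g : (ℕ × ℕ) ⊕ ℕ → ℂ → ℂ := fun x s =>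
    if termExponent α m x = n then termCoeff F d x * φ (termPower x) (s - n)
    else termCoeff F d x * logPole Ψ (termPower x) (s - termExponent α m x) with hg
  have hgc : ∀ x, ContinuousAt (g x) n := by
    intro x
    by_cases hx : termExponent α m x = n
    · simp only [hg, hx, if_true]
      have := (hφ (termPower x)).continuous
      fun_prop
    · simp only [hg, hx, if_false]
      have h1 : ContinuousAt (logPole Ψ (termPower x)) ((n : ℂ) - termExponent α m x) :=
        (analyticAt_logPole Ψ _ (sub_ne_zero.2 (Ne.symm hx))).continuousAt
      exact continuousAt_const.mul
        (ContinuousAt.comp' (f := fun s => s - termExponent α m x) h1 (by fun_prop))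
  have hpoles : ∀ s, s ≠ (n : ℂ) → ∑ x ∈ termIndex N M p, termCoeff F d x *
      logPole Ψ (termPower x) (s - termExponent α m x) =
      Q s * (s - n)⁻¹ + ∑ x ∈ termIndex N M p, g x s := by
    intro s hs
    simp only [hQ, hJ]
    rw [Finset.sum_filter, Finset.sum_mul, ← Finset.sum_add_distrib]
    refine Finset.sum_congr rfl fun x _ => ?_
    by_cases hx : termExponent α m x = n
    · simp only [hg, hx, if_true]
      rw [hφ' _ _ (sub_ne_zero.2 hs), hc', mul_add, div_eq_mul_inv, pow_succ, mul_inv, inv_pow]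
      ring
    · simp only [hg, hx, if_false, zero_mul, zero_add]
  set B : ℂ → ℂ := fun s => Complex.exp (-s * (Ψ * Complex.I)) *
        (mellin ((Set.Iic 1).indicator (rayTail F Ψ p)) (1 - s) - rayPrim F L Ψ p 1 +
          s * mellin ((Set.Ioi 1).indicator (rayRem L Ψ α m d N M)) (-s)) +
      s * ∑ x ∈ termIndex N M p, g x s with hB
  have hBc : ContinuousAt B n := by
    have h1 := (analyticAt_mellin_rayTail hS hF hp (s := n) (by simp; linarith)).continuousAt
    have h2 := (analyticAt_mellin_rayRem hS hL hE (s := n) (by simpa using hn)).continuousAt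
    have h3 : ContinuousAt (fun s => ∑ x ∈ termIndex N M p, g x s) n :=
      tendsto_finsetSum _ fun x _ => hgc x
    have h4 : ContinuousAt (fun s : ℂ => Complex.exp (-s * (Ψ * Complex.I))) n := by fun_prop
    exact (h4.mul ((h1.sub continuousAt_const).add (continuousAt_id.mul h2))).add
      (continuousAt_id.mul h3)
  set W : ℂ → ℂ := fun s => Complex.exp (s * (Real.pi * Complex.I)) *
      (Complex.sin (Real.pi * s) / Real.pi) / (s - n) with hW
  have hWlim : Tendsto W (𝓝[≠] (n : ℂ)) (𝓝 1) := tendsto_exp_mul_sin_div n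
  have hid : Tendsto (fun s : ℂ => s) (𝓝[≠] (n : ℂ)) (𝓝 n) := nhdsWithin_le_nhds
  have hW0 : ∀ᶠ s in 𝓝[≠] (n : ℂ), W s * s ≠ 0 := by
    have : Tendsto (fun s => W s * s) (𝓝[≠] (n : ℂ)) (𝓝 n) := by simpa using hWlim.mul hid
    exact this.eventually_ne hn0'
  have hQlim : Tendsto Q (𝓝[≠] (n : ℂ)) (𝓝 (Z n / n)) := by
    have h1 : Tendsto (fun s => (Z s - W s * (s - n) * B s) / (W s * s)) (𝓝[≠] (n : ℂ))
        (𝓝 ((Z n - 1 * (n - n) * B n) / (1 * n))) := by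
      refine Tendsto.div ?_ (hWlim.mul hid) (by simpa using hn0')
      exact (hZ.tendsto.mono_left nhdsWithin_le_nhds).sub
        ((hWlim.mul (hid.sub_const _)).mul (hBc.tendsto.mono_left nhdsWithin_le_nhds))
    simp only [sub_self, mul_zero, zero_mul, sub_zero, one_mul] at h1
    refine h1.congr' ?_
    filter_upwards [hW0, hZeq, self_mem_nhdsWithin] with s hs hZs hsn
    have hsn' : s - n ≠ 0 := sub_ne_zero.2 hsn
    rw [div_eq_iff hs, hZs, zetaCont, hpoles s hsn, hB]
    simp only [hW]
    field_simp
    ring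
  have h := eq_sum_of_tendsto_sum_inv_pow J c' termPower hQlim
  rw [div_eq_iff hn0', mul_comm] at h
  rw [h, hJ, Finset.filter_filter]
  congr 1
  refine Finset.sum_congr rfl fun x hx => ?_
  simp only [hc', (Finset.mem_filter.1 hx).2.2]
  simp

end

theorem sum_termCoeff_filter (F : ℂ → ℂ) (d : ℕ → ℕ → ℂ) (α : ℝ) (m N M p : ℕ) (n : ℤ) :
    ∑ x ∈ termIndex N M p with termExponent α m x = n ∧ termPower x = 0, termCoeff F d x =
      (∑ j ∈ Finset.range (N + 1), if α - (j : ℝ) / (m : ℝ) = n then d j 0 else 0) -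
        ∑ i ∈ Finset.range p, if (i : ℤ) + 1 = n then logCoeff (taylorCoeff F) (i + 1) else 0 := by
  rw [Finset.sum_filter, termIndex, Finset.sum_disjSum, Finset.sum_product, sub_eq_add_neg,
    ← Finset.sum_neg_distrib]
  congr 1
  · refine Finset.sum_congr rfl fun j _ => ?_
    simp only [termExponent, termPower, termCoeff, Sum.elim_inl]
    have h : ((α - (j : ℝ) / (m : ℝ) : ℝ) : ℂ) = n ↔ α - (j : ℝ) / (m : ℝ) = n := by
      rw [← Complex.ofReal_intCast, Complex.ofReal_inj]
    simp only [h]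
    rw [Finset.sum_eq_single 0]
    · simp
    · intro k _ hk
      simp [hk]
    · simp
  · refine Finset.sum_congr rfl fun i _ => ?_
    simp only [termExponent, termPower, termCoeff, Sum.elim_inr, and_true]
    have h : (i : ℂ) + 1 = n ↔ (i : ℤ) + 1 = n := by norm_cast
    simp only [h]
    split_ifs <;> simp

/-! ### Uniqueness and gluing of continuations. -/

/-- The difference has infinite order at a point where the series converges, hence everywhere on the
connected half-plane. Agreement is only punctured, as values of a meromorphic function at isolated
points are arbitrary. -/
theorem IsZetaContinuation.eventuallyEq {a : ℕ → ℂ} {Ψ α c : ℝ} {Z₁ Z₂ : ℂ → ℂ}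
    (h₁ : IsZetaContinuation a Ψ α {s | c < s.re} Z₁)
    (h₂ : IsZetaContinuation a Ψ α {s | c < s.re} Z₂) {s : ℂ} (hs : c < s.re) :
    Z₁ =ᶠ[𝓝[≠] s] Z₂ := by
  have hm : MeromorphicOn (Z₁ - Z₂) {s | c < s.re} := h₁.1.sub h₂.1
  have htop : meromorphicOrderAt (Z₁ - Z₂) ((max α c + 1 : ℝ) : ℂ) = ⊤ := by
    rw [meromorphicOrderAt_eq_top_iff]
    have hopen : {s : ℂ | α < s.re} ∈ 𝓝 ((max α c + 1 : ℝ) : ℂ) :=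
      (isOpen_lt continuous_const Complex.continuous_re).mem_nhds (by
        rw [Set.mem_ofPred_eq, Complex.ofReal_re]; linarith [le_max_left α c])
    filter_upwards [mem_nhdsWithin_of_mem_nhds hopen] with z hz
    rw [Pi.sub_apply, (h₁.2 z hz).unique (h₂.2 z hz), sub_self]
  have htop' : meromorphicOrderAt (Z₁ - Z₂) s = ⊤ := by
    by_contra hne
    exact hm.meromorphicOrderAt_ne_top_of_isPreconnected (convex_halfSpace_re_gt c).isPreconnected
      hs (show c < ((max α c + 1 : ℝ) : ℂ).re by
        rw [Complex.ofReal_re]; linarith [le_max_right α c]) hne htop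
  rw [meromorphicOrderAt_eq_top_iff] at htop'
  filter_upwards [htop'] with z hz using sub_eq_zero.1 hz

section

variable {a : ℕ → ℂ} {Ψ ε α : ℝ} {F L : ℂ → ℂ} {m : ℕ} {d : ℕ → ℕ → ℂ} {N M : ℕ} {δ : ℝ}

/-- The series and the formula agree on `α < Re s < ⌊α⌋ + 1`, so defining `Z` by cases on `α < Re s`
creates no seam. -/
theorem exists_isZetaContinuation (hS : IsZetaSequence a Ψ ε α)
    (hF : IsCharacteristicFunction a α F) (hL : IsLogBranchOn F L (sector Ψ ε)) (hδ : 0 < δ)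
    (hE : HasLogExpansion L Ψ ε α m d N M δ) :
    ∃ Z : ℂ → ℂ, IsZetaContinuation a Ψ α {s : ℂ | α - (N : ℝ) / (m : ℝ) - δ < s.re} Z ∧
      ∀ s : ℂ, s.re ≤ α → Z =ᶠ[𝓝 s] zetaCont F L Ψ α m d N M ⌊α⌋₊ := by
  set p := ⌊α⌋₊
  have hp : (p : ℝ) ≤ α := Nat.floor_le hS.exponent_nonneg
  have hp' : α < p + 1 := Nat.lt_floor_add_one α
  set Z : ℂ → ℂ := fun s =>
    if α < s.re then ∑' n, cutPow Ψ (a n) (-s) else zetaCont F L Ψ α m d N M p s with hZ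
  have hZ1 : ∀ s : ℂ, α < s.re → Z s = ∑' n, cutPow Ψ (a n) (-s) := fun s hs => if_pos hs
  have hZ2 : ∀ s : ℂ, s.re < p + 1 → Z s = zetaCont F L Ψ α m d N M p s := by
    intro s hs
    by_cases h : α < s.re
    · rw [hZ1 s h, tsum_cutPow_eq_zetaCont hS hF hL hδ hE hp h hs]
    · exact if_neg h
  have hZ3 : ∀ s : ℂ, s.re ≤ α → Z =ᶠ[𝓝 s] zetaCont F L Ψ α m d N M p := by
    intro s hs
    filter_upwards [(isOpen_lt Complex.continuous_re continuous_const).mem_nhds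
      (show s.re < (p : ℝ) + 1 by linarith)] with z hz using hZ2 z hz
  refine ⟨Z, ⟨fun s hs => ?_, fun s hs => ?_⟩, hZ3⟩
  · rcases le_or_gt s.re α with h | h
    · exact (meromorphicAt_zetaCont hS hF hL hE hp' (by linarith) hs).congr
        (((hZ3 s h).filter_mono nhdsWithin_le_nhds).symm)
    · have hopen : {s : ℂ | α < s.re} ∈ 𝓝 s :=
        (isOpen_lt continuous_const Complex.continuous_re).mem_nhds h
      have hd : DifferentiableOn ℂ Z {s | α < s.re} := fun w hw =>
        (((hS.differentiableAt_tsum_cutPow hw).differentiableWithinAt).congr (fun z hz => hZ1 z hz)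
          (hZ1 w hw))
      exact (hd.analyticAt hopen).meromorphicAt
  · rw [hZ1 s hs]
    exact (hS.summable_cutPow hs).hasSum

/-- The values of a continuation at nonzero integers. -/
theorem IsZetaContinuation.apply_intCast (hS : IsZetaSequence a Ψ ε α)
    (hF : IsCharacteristicFunction a α F) (hL : IsLogBranchOn F L (sector Ψ ε)) (hδ : 0 < δ)
    (hE : HasLogExpansion L Ψ ε α m d N M δ) {Z : ℂ → ℂ}
    (hZ : IsZetaContinuation a Ψ α {s : ℂ | α - (N : ℝ) / (m : ℝ) - δ < s.re} Z) {n : ℤ}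
    (hn0 : n ≠ 0) (hnα : (n : ℝ) ≤ α) (hn : α - (N : ℝ) / (m : ℝ) - δ < n)
    (hZn : ContinuousAt Z n) :
    Z n = n * ((∑ j ∈ Finset.range (N + 1), if α - (j : ℝ) / (m : ℝ) = n then d j 0 else 0) -
      if 1 ≤ n then logCoeff (taylorCoeff F) n.toNat else 0) := by
  obtain ⟨Z₀, hZ₀, hZ₀'⟩ := exists_isZetaContinuation hS hF hL hδ hE
  have heq := (hZ.eventuallyEq hZ₀ (s := n) (by simpa using hn)).trans
    ((hZ₀' n (by simpa using hnα)).filter_mono nhdsWithin_le_nhds)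
  rw [apply_intCast_eq_of_eventuallyEq_zetaCont hS hF hL hE (Nat.lt_floor_add_one α) hn0 hnα hn
    hZn heq, sum_termCoeff_filter]
  congr 2
  split_ifs with h
  -- The coefficient `b_n` sits at index `i = n - 1`, which lies in the range because `n ≤ ⌊α⌋`.
  · rw [Finset.sum_eq_single (n.toNat - 1)]
    · rw [if_pos (by omega)]
      congr 1
      omega
    · intro i _ hi
      rw [if_neg (by omega)]
    · intro hmem
      exfalso
      apply hmem
      rw [Finset.mem_range]
      have h1 : ((n.toNat : ℕ) : ℝ) ≤ α := by
        have : ((n.toNat : ℤ) : ℝ) = n := by rw [Int.toNat_of_nonneg (by omega)]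
        have h2 : ((n.toNat : ℕ) : ℝ) = n := by exact_mod_cast this
        rw [h2]; exact hnα
      have := Nat.le_floor h1
      omega
  · refine Finset.sum_eq_zero fun i _ => if_neg (by omega)

theorem sum_ite_exponent_eq (hm : 0 < m) {N j : ℕ} (hj : j ≤ N) {n : ℤ}
    (h : α - (j : ℝ) / (m : ℝ) = n) :
    (∑ j ∈ Finset.range (N + 1), if α - (j : ℝ) / (m : ℝ) = n then d j 0 else 0) = d j 0 := by
  rw [Finset.sum_eq_single j, if_pos h]
  · intro i _ hi
    refine if_neg fun h' => hi ?_
    have hm' : (m : ℝ) ≠ 0 := by exact_mod_cast hm.ne'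
    have : (i : ℝ) / m = (j : ℝ) / m := by linarith
    rw [div_left_inj' hm'] at this
    exact_mod_cast this
  · intro hmem
    exact absurd (Finset.mem_range.2 (by omega)) hmem

/-- At `s` the continuation belonging to the least `N` with `α - N/m < Re s` is used. Near a given
point only finitely many `N` occur, and any two of these continuations agree off that point. -/
theorem exists_isZetaContinuation_univ (hS : IsZetaSequence a Ψ ε α)
    (hF : IsCharacteristicFunction a α F) (hL : IsLogBranchOn F L (sector Ψ ε)) (hm : 0 < m)
    (hE : ∀ N : ℕ, ∃ M : ℕ, ∃ δ : ℝ, 0 < δ ∧ HasLogExpansion L Ψ ε α m d N M δ) :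
    ∃ Z : ℂ → ℂ, IsZetaContinuation a Ψ α Set.univ Z := by
  choose M δ hδ hE using hE
  choose Z hZ _ using fun N => exists_isZetaContinuation hS hF hL (hδ N) (hE N)
  have hmono : ∀ (N : ℕ) {c : ℝ}, α - (N : ℝ) / (m : ℝ) - δ N ≤ c →
      IsZetaContinuation a Ψ α {s : ℂ | c < s.re} (Z N) := fun N {c} hc =>
    ⟨fun s hs => (hZ N).1 s (lt_of_le_of_lt hc hs), (hZ N).2⟩
  have hm' : (0 : ℝ) < m := by exact_mod_cast hm
  have hex : ∀ s : ℂ, ∃ N : ℕ, α - (N : ℝ) / (m : ℝ) < s.re := by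
    intro s
    obtain ⟨N, hN⟩ := exists_nat_gt ((α - s.re) * m)
    refine ⟨N, ?_⟩
    rw [← lt_div_iff₀ hm'] at hN
    linarith
  classical
  set ν : ℂ → ℕ := fun s => Nat.find (hex s) with hν
  refine ⟨fun s => Z (ν s) s, fun s _ => ?_, fun s hs => ?_⟩
  · set K := ν s with hK
    have hKs : α - (K : ℝ) / (m : ℝ) < s.re := Nat.find_spec (hex s)
    refine ((hmono K (c := α - (K : ℝ) / (m : ℝ)) (by linarith [hδ K])).1 s hKs).congr ?_
    have hopen : {z : ℂ | α - (K : ℝ) / (m : ℝ) < z.re} ∈ 𝓝 s :=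
      (isOpen_lt continuous_const Complex.continuous_re).mem_nhds hKs
    have hagree : ∀ᶠ z in 𝓝[≠] s, ∀ N ∈ Finset.range (K + 1),
        α - (N : ℝ) / (m : ℝ) < z.re → Z K z = Z N z := by
      rw [Filter.eventually_all_finset]
      intro N _
      -- Equality, where the selected index jumps, belongs to the first case: the margin `δ N > 0`
      -- keeps `s` inside the half-plane of `Z N`.
      rcases le_or_gt (α - (N : ℝ) / (m : ℝ)) s.re with hN | hN
      · have hK' : α - (K : ℝ) / (m : ℝ) - δ K < s.re := by linarith [hδ K]
        have hN' : α - (N : ℝ) / (m : ℝ) - δ N < s.re := by linarith [hδ N]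
        have h1 := (hmono K (le_max_left _ (α - (N : ℝ) / (m : ℝ) - δ N))).eventuallyEq
          (hmono N (le_max_right (α - (K : ℝ) / (m : ℝ) - δ K) _)) (max_lt hK' hN')
        filter_upwards [h1] with z hz _ using hz
      · have hopen' : {z : ℂ | z.re < α - (N : ℝ) / (m : ℝ)} ∈ 𝓝 s :=
          (isOpen_lt Complex.continuous_re continuous_const).mem_nhds hN
        filter_upwards [mem_nhdsWithin_of_mem_nhds hopen'] with z hz h
        exact absurd h (not_lt.2 (le_of_lt hz))
    filter_upwards [hagree, mem_nhdsWithin_of_mem_nhds hopen] with z hz hzK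
    exact hz (ν z) (Finset.mem_range.2 (Nat.lt_succ_of_le (Nat.find_min' (hex z) hzK)))
      (Nat.find_spec (hex z))
  · have h0 : ν s = 0 := by
      rw [hν, Nat.find_eq_zero]
      simpa using hs
    simp only [h0]
    exact (hZ 0).2 s hs

end

/-- The first part treats an expansion to all orders, the second one an expansion to a fixed
finite order, where the integer `n` has to lie in the half-plane reached by the continuation. -/
theorem mainTheorem7 (a : ℕ → ℂ) (Ψ ε α : ℝ) (hS : IsZetaSequence a Ψ ε α)
    (F : ℂ → ℂ) (hF : IsCharacteristicFunction a α F)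
    (L : ℂ → ℂ) (hL : IsLogBranchOn F L (sector Ψ ε))
    (m : ℕ) (hm : 0 < m) (d : ℕ → ℕ → ℂ) :
    ((∀ N : ℕ, ∃ M : ℕ, ∃ δ : ℝ, 0 < δ ∧ HasLogExpansion L Ψ ε α m d N M δ) →
      (∃ Z : ℂ → ℂ, IsZetaContinuation a Ψ α Set.univ Z) ∧
      ∀ Z : ℂ → ℂ, IsZetaContinuation a Ψ α Set.univ Z →
        ∀ n : ℤ, n ≠ 0 → (n : ℝ) ≤ α → AnalyticAt ℂ Z (n : ℂ) →
          (1 ≤ n → (∀ j : ℕ, α - (j : ℝ) / (m : ℝ) ≠ (n : ℝ)) →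
            Z (n : ℂ) = -(n : ℂ) * logCoeff (taylorCoeff F) n.toNat) ∧
          (1 ≤ n → ∀ j : ℕ, α - (j : ℝ) / (m : ℝ) = (n : ℝ) →
            Z (n : ℂ) = (n : ℂ) * (d j 0 - logCoeff (taylorCoeff F) n.toNat)) ∧
          (n < 0 → (∀ j : ℕ, α - (j : ℝ) / (m : ℝ) ≠ (n : ℝ)) → Z (n : ℂ) = 0) ∧
          (n < 0 → ∀ j : ℕ, α - (j : ℝ) / (m : ℝ) = (n : ℝ) →
            Z (n : ℂ) = (n : ℂ) * d j 0)) ∧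
    (∀ (N M : ℕ) (δ : ℝ), 0 < δ → HasLogExpansion L Ψ ε α m d N M δ →
      (∃ Z : ℂ → ℂ,
        IsZetaContinuation a Ψ α {s : ℂ | α - (N : ℝ) / (m : ℝ) - δ < s.re} Z) ∧
      ∀ Z : ℂ → ℂ,
        IsZetaContinuation a Ψ α {s : ℂ | α - (N : ℝ) / (m : ℝ) - δ < s.re} Z →
        ∀ n : ℤ, n ≠ 0 → (n : ℝ) ≤ α → α - (N : ℝ) / (m : ℝ) - δ < (n : ℝ) →
          AnalyticAt ℂ Z (n : ℂ) →
          (1 ≤ n → (∀ j : ℕ, j ≤ N → α - (j : ℝ) / (m : ℝ) ≠ (n : ℝ)) →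
            Z (n : ℂ) = -(n : ℂ) * logCoeff (taylorCoeff F) n.toNat) ∧
          (1 ≤ n → ∀ j : ℕ, j ≤ N → α - (j : ℝ) / (m : ℝ) = (n : ℝ) →
            Z (n : ℂ) = (n : ℂ) * (d j 0 - logCoeff (taylorCoeff F) n.toNat)) ∧
          (n < 0 → (∀ j : ℕ, j ≤ N → α - (j : ℝ) / (m : ℝ) ≠ (n : ℝ)) →
            Z (n : ℂ) = 0) ∧
          (n < 0 → ∀ j : ℕ, j ≤ N → α - (j : ℝ) / (m : ℝ) = (n : ℝ) →
            Z (n : ℂ) = (n : ℂ) * d j 0)) := by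
  have hfin : ∀ (N M : ℕ) (δ : ℝ), 0 < δ → HasLogExpansion L Ψ ε α m d N M δ →
      ∀ Z : ℂ → ℂ,
        IsZetaContinuation a Ψ α {s : ℂ | α - (N : ℝ) / (m : ℝ) - δ < s.re} Z →
        ∀ n : ℤ, n ≠ 0 → (n : ℝ) ≤ α → α - (N : ℝ) / (m : ℝ) - δ < (n : ℝ) →
          AnalyticAt ℂ Z (n : ℂ) →
          (1 ≤ n → (∀ j : ℕ, j ≤ N → α - (j : ℝ) / (m : ℝ) ≠ (n : ℝ)) →
            Z (n : ℂ) = -(n : ℂ) * logCoeff (taylorCoeff F) n.toNat) ∧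
          (1 ≤ n → ∀ j : ℕ, j ≤ N → α - (j : ℝ) / (m : ℝ) = (n : ℝ) →
            Z (n : ℂ) = (n : ℂ) * (d j 0 - logCoeff (taylorCoeff F) n.toNat)) ∧
          (n < 0 → (∀ j : ℕ, j ≤ N → α - (j : ℝ) / (m : ℝ) ≠ (n : ℝ)) →
            Z (n : ℂ) = 0) ∧
          (n < 0 → ∀ j : ℕ, j ≤ N → α - (j : ℝ) / (m : ℝ) = (n : ℝ) →
            Z (n : ℂ) = (n : ℂ) * d j 0) := by
    intro N M δ hδ hE Z hZ n hn0 hnα hn hZn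
    have hval := hZ.apply_intCast hS hF hL hδ hE hn0 hnα hn hZn.continuousAt
    have hnone : (∀ j : ℕ, j ≤ N → α - (j : ℝ) / (m : ℝ) ≠ (n : ℝ)) →
        (∑ j ∈ Finset.range (N + 1), if α - (j : ℝ) / (m : ℝ) = n then d j 0 else 0) = 0 :=
      fun h => Finset.sum_eq_zero fun j hj => if_neg (h j (by simpa [Nat.lt_succ_iff] using hj))
    refine ⟨fun h1 h => ?_, fun h1 j hj h => ?_, fun h1 h => ?_, fun h1 j hj h => ?_⟩
    · rw [hval, hnone h, if_pos h1]
      ring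
    · rw [hval, sum_ite_exponent_eq hm hj h, if_pos h1]
    · rw [hval, hnone h, if_neg (by omega)]
      ring
    · rw [hval, sum_ite_exponent_eq hm hj h, if_neg (by omega), sub_zero]
  refine ⟨fun hE => ⟨exists_isZetaContinuation_univ hS hF hL hm hE,
    fun Z hZ n hn0 hnα hZn => ?_⟩, fun N M δ hδ hE => ⟨?_, hfin N M δ hδ hE⟩⟩
  · have hm' : (0 : ℝ) < m := by exact_mod_cast hm
    -- From order `K` on, the half-plane of the finite-order result contains `n`, whatever the
    -- values `δ N > 0`.
    obtain ⟨K, hK⟩ := exists_nat_gt ((α - n) * m)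
    rw [← lt_div_iff₀ hm'] at hK
    choose M δ hδ hE using hE
    have hKN : ∀ N : ℕ, K ≤ N → α - (N : ℝ) / (m : ℝ) - δ N < n := fun N hN => by
      have : (K : ℝ) / m ≤ (N : ℝ) / m := by gcongr
      linarith [hδ N]
    have key := fun (N : ℕ) (hN : K ≤ N) => hfin N (M N) (δ N) (hδ N) (hE N) Z
      ⟨fun s _ => hZ.1 s (Set.mem_univ s), hZ.2⟩ n hn0 hnα (hKN N hN) hZn
    refine ⟨fun h1 h => (key K le_rfl).1 h1 fun j _ => h j, fun h1 j h => ?_,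
      fun h1 h => (key K le_rfl).2.2.1 h1 fun j _ => h j, fun h1 j h => ?_⟩
    -- The order must also be at least `j`, so that the term with exponent `n` belongs to the
    -- expansion.
    · exact (key (max K j) (le_max_left _ _)).2.1 h1 j (le_max_right _ _) h
    · exact (key (max K j) (le_max_left _ _)).2.2.2 h1 j (le_max_right _ _) h
  · obtain ⟨Z, hZ, -⟩ := exists_isZetaContinuation hS hF hL hδ hE
    exact ⟨Z, hZ⟩
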